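/- Let $p_n\in(0,1)$ for $n\ge 0$ and $q_n\in(0,1)$ for $n\ge 1$, with $p_n+q_n=1$ and $p_n\le q_n$ for $n\geq 1$, $\inf_n p_n>0$, and $\sum_{n\ge1}\prod_{i=1}^n\frac{p_{i-1}}{q_i}<\infty$. Put $R_n=\prod_{i=1}^n\frac{p_i}{q_i}$ and $S_n=\sum_{i\ge n}R_i$ for $n\geq 1$, and assume $\sum_{n\ge1}S_n^2/R_n<\infty$. Let $\varphi:\mathbb N\to(0,1]$ be non-increasing with $\varphi(0)=1$ and $\lim_{n\to\infty}\varphi(n)=0$. Let $Q$ be the Q-matrix on $\mathbb N=\{0,1,2,\dots\}$ of the birth-and-death process with birth rates $(p_n)_{n\ge0}$ and death rates $(q_n)_{n\ge1}$, let $\nu$ be its equilibrium distribution, $\nu_n=\mathrm{const}\prod_{i=1}^n\frac{p_{i-1}}{q_i}$, and let $Q^\psi=\mathrm{diag}(1/\varphi)\,Q$. For a Q-matrix $Q'$, $e^{tQ'}$ denotes the associated semigroup, i.e. the minimal nonnegative solution of the backward equation $P_t'=Q'P_t$, $P_0=I$. For measures on $\mathbb N$, $\mu_1\preceq\mu_2$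 means $\mu_1(\{k+1,k+2,\dots\})\le\mu_2(\{k+1,k+2,\dots\})$ for all $k\in\mathbb N$. (1) For every $t\ge0$, $\nu e^{tQ^\psi}$ is a probability measure and $\nu e^{tQ^\psi}\preceq\nu$. (2) Let $d\ge1$, let $\omega_0=(\omega_0(t))_{t\ge0}$ be a càdlàg Markov jump process on $\mathbb N$ with Q-matrix $Q$ and $\omega_0(0)\sim\nu$, and let $\mathcal M$ be a Poisson point process of rate $1$ on $\mathbb R^d\times\mathbb R_+$, independent of $\omega_0$. Let $\tau_1$ be the infimum of the $r>0$ such that there is a point $(y,s)\in\mathcal M$ with $0<s\le r$, $y\in[-\frac12,\frac12)^d$ and $y_d<-\frac12+\varphi(\omega_0(s))$; this is the first jump time of a walk started at the origin of $\mathbb Z^d$, with jump rate $\varphi(\omega_0(t))$ there at time $t$. Then $\tau_1<\infty$ almost surely, and the law of $\omega_0(\tau_1)$ is stochastically dominated by $\nu$: $\omega_0(\tau_1)\preceq\nu$. -/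

import Mathlib

open MeasureTheory ProbabilityTheory Set Filter Topology
open scoped NNReal ENNReal

noncomputable section

/-! ### Stochastic order on `ℕ` and birth-and-death generators -/

/-- Stochastic domination `μ₁ ⪯ μ₂` of measures on `ℕ`:
`μ₁ (ℕ \ {0, …, k}) ≤ μ₂ (ℕ \ {0, …, k})` for every `k`. -/
def StochDominated (μ₁ μ₂ : Measure ℕ) : Prop :=
  ∀ k : ℕ, μ₁ (Set.Iic k)ᶜ ≤ μ₂ (Set.Iic k)ᶜ

/-- The Q-matrix of the birth-and-death process on `ℕ` with birth rates `p n`, `n ≥ 0`, and death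
rates `q n`, `n ≥ 1`. The value `q 0` is not used. -/
def bdGenerator (p q : ℕ → ℝ) : ℕ → ℕ → ℝ := fun n m =>
  if m = n + 1 then p n
  else if n = m + 1 then q n
  else if m = n then -(p n + if n = 0 then 0 else q n)
  else 0

/-- The time-changed Q-matrix `diag (1 / φ) * Q`. -/
def timeChanged (φ : ℕ → ℝ) (Q : ℕ → ℕ → ℝ) : ℕ → ℕ → ℝ := fun n m =>
  1 / φ n * Q n m

/-- The weights `∏_{i=1}^n p_{i-1} / q_i` of the reversible measure. -/
def bdWeight (p q : ℕ → ℝ) (n : ℕ) : ℝ := ∏ i ∈ Finset.Icc 1 n, p (i - 1) / q i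

/-- The equilibrium distribution `ν` of the birth-and-death process: the normalized weights. -/
def bdEquilibrium (p q : ℕ → ℝ) : Measure ℕ :=
  Measure.sum fun n =>
    ENNReal.ofReal (bdWeight p q n / ∑' m, bdWeight p q m) • Measure.dirac n

/-- `R_n = ∏_{i=1}^n p_i / q_i`. -/
def bdR (p q : ℕ → ℝ) (n : ℕ) : ℝ := ∏ i ∈ Finset.Icc 1 n, p i / q i

/-- `S_n = ∑_{i ≥ n} R_i`. -/
def bdS (p q : ℕ → ℝ) (n : ℕ) : ℝ := ∑' i, bdR p q (n + i)

/-! ### The semigroup of a Q-matrix -/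

/-- The Picard iterates, started from `0`, of the integrated backward equation
`P_t(i,j) = 1{i = j} e^{-q_i t} + ∫₀ᵗ e^{-q_i s} ∑_{m ≠ i} Q(i,m) P_{t-s}(m,j) ds`, `q_i = -Q(i,i)`.
The `k`-th iterate is the probability that the chain started from `i` is in `j` at time `t`, having
made fewer than `k` jumps. -/
def semigroupIter (Q : ℕ → ℕ → ℝ) : ℕ → ℝ → ℕ → ℕ → ℝ≥0∞
  | 0, _, _, _ => 0
  | k + 1, t, i, j =>
      (if i = j then ENNReal.ofReal (Real.exp (Q i i * t)) else 0) +
        ∫⁻ s in Set.Icc 0 t, ENNReal.ofReal (Real.exp (Q i i * s)) *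
          ∑' m, if m = i then 0 else ENNReal.ofReal (Q i m) * semigroupIter Q k (t - s) m j

/-- The semigroup `e^{tQ}` associated to the Q-matrix `Q`: the minimal nonnegative solution of the
backward equation `P' = Q P`, `P_0 = I`, which is the increasing limit of the iterates. -/
def qSemigroup (Q : ℕ → ℕ → ℝ) (t : ℝ≥0) (i j : ℕ) : ℝ≥0∞ :=
  ⨆ k, semigroupIter Q k t i j

/-- The measure `μ e^{tQ}` (row vector times matrix). -/
def evolve (μ : Measure ℕ) (Q : ℕ → ℕ → ℝ) (t : ℝ≥0) : Measure ℕ :=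
  Measure.sum fun j => (∑' i, μ {i} * qSemigroup Q t i j) • Measure.dirac j

/-! ### Environment process, Poisson point process, first jump time -/

/-- `Y` is a Markov jump process on `ℕ` with càdlàg paths, Q-matrix `Q` and initial distribution
`μ`, on the probability space `(Ω, P)`. -/
structure IsMarkovJumpProcess {Ω : Type*} [MeasurableSpace Ω] (P : Measure Ω)
    (Q : ℕ → ℕ → ℝ) (μ : Measure ℕ) (Y : ℝ≥0 → Ω → ℕ) : Prop where
  measurable : ∀ t, Measurable (Y t)
  right_continuous : ∀ ω t, ContinuousWithinAt (fun s => Y s ω) (Set.Ici t) t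
  left_limits : ∀ ω t, ∃ l : ℕ, Tendsto (fun s => Y s ω) (𝓝[<] t) (𝓝 l)
  finite_dim : ∀ (n : ℕ) (s : ℕ → ℝ≥0) (i : ℕ → ℕ), s 0 = 0 → Monotone s →
    P {ω | ∀ k ≤ n, Y (s k) ω = i k} =
      μ {i 0} * ∏ k ∈ Finset.range n, qSemigroup Q (s (k + 1) - s k) (i k) (i (k + 1))

/-- The random set `M` of points of `E` is a Poisson point process with intensity measure `Λ`:
the numbers of points in disjoint measurable sets are independent, and Poisson distributed with
parameter `Λ A` for sets `A` with `Λ A < ∞`. -/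
structure IsPoissonPointProcess {Ω E : Type*} [MeasurableSpace Ω] [MeasurableSpace E]
    (P : Measure Ω) (Λ : Measure E) (M : Ω → Set E) : Prop where
  measurable_count : ∀ A, MeasurableSet A → Measurable fun ω => (M ω ∩ A).encard
  poisson_count : ∀ A, MeasurableSet A → Λ A < ∞ → ∀ k : ℕ,
    P {ω | (M ω ∩ A).encard = k} = poissonMeasure (Λ A).toNNReal {k}
  independent_counts : ∀ (n : ℕ) (A : Fin n → Set E), (∀ i, MeasurableSet (A i)) →
    (Pairwise fun i j => Disjoint (A i) (A j)) →
      iIndepFun (fun i ω => (M ω ∩ A i).encard) P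

/-- Lebesgue measure on `ℝ₊`. -/
def nnrealLebesgue : Measure ℝ≥0 :=
  ((volume : Measure ℝ).restrict (Set.Ici 0)).map Real.toNNReal

/-- Lebesgue measure on `ℝ^{d+1} × ℝ₊`, the intensity of a Poisson point process of rate `1`. -/
def spaceTimeLebesgue (d : ℕ) : Measure ((Fin (d + 1) → ℝ) × ℝ≥0) :=
  (volume : Measure (Fin (d + 1) → ℝ)).prod nnrealLebesgue

/-- The unit cube `[-1/2, 1/2)^{d+1}` attached to the origin of `ℤ^{d+1}`. -/
def originCube (d : ℕ) : Set (Fin (d + 1) → ℝ) := {y | ∀ i, y i ∈ Set.Ico (-1 / 2 : ℝ) (1 / 2)}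

/-- The points `(y, r)` of `M` with `y` in the cube of the origin that are retained at time `r`
given the environment path `w` at the origin: those whose last space coordinate lies in
`[-1/2, -1/2 + φ (w r))`. -/
def retainedPoints {d : ℕ} (φ : ℕ → ℝ) (w : ℝ≥0 → ℕ) (M : Set ((Fin (d + 1) → ℝ) × ℝ≥0)) :
    Set ((Fin (d + 1) → ℝ) × ℝ≥0) :=
  {z ∈ M | z.1 ∈ originCube d ∧
    z.1 (Fin.last d) ∈ Set.Ico (-1 / 2 : ℝ) (-1 / 2 + φ (w z.2))}

/-- The first jump time `τ₁` of the walk started at the origin: the infimum (`∞` if there is none)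
of the times `r > 0` such that some retained point has its time coordinate in `(0, r]`. -/
def firstJumpTime {d : ℕ} (φ : ℕ → ℝ) (w : ℝ≥0 → ℕ) (M : Set ((Fin (d + 1) → ℝ) × ℝ≥0)) : ℝ≥0∞ :=
  sInf ((fun r : ℝ≥0 => (r : ℝ≥0∞)) ''
    {r | 0 < r ∧ (retainedPoints φ w M ∩ originCube d ×ˢ Set.Ioc 0 r).Nonempty})

end

/-! Part (1). Detailed balance for `ν` says that `φν` is reversible for `Q^ψ`. Fix `k`, let `u` be
the indicator of `{0,…,k}` and `g i = 1/φ(min i k)`. Then `g` is bounded and nondecreasing, and `gφν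
≤ ν` with equality on `{0,…,k}`. Birth-and-death semigroups preserve nonincreasing functions, and
summation by parts gives `∑ gφν · Q^ψ x ≥ 0` for nonincreasing `x`, up to a flux at infinity
(`sum_mul_bdDrift_ge`). Hence `ν e^{tQ^ψ} u ≥ ∑ gφν · e^{tQ^ψ} u ≥ ∑ gφν u = ν u`, which is the
domination after passing to complements. The choice `g = u = 1` rules out explosion.

Since the rates `p/φ`, `q/φ` are unbounded, this is carried out for the chain killed on reaching `N`
(`exists_killed_semigroup`). That chain lies below the minimal semigroup (`killed_le_iSup_bdIter`),
and its boundary flux is at most a constant times `ν_N p_N`, which tends to `0`.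

Part (2). On the clock `∫ φ(ω₀)` the environment is a `Q^ψ`-chain and the walk jumps at rate `1`, so
the law of `ω₀(τ₁)` is `ν` times the resolvent of `Q^ψ` at `1`, to which the same summation by parts
applies. No time change is constructed. Instead the resolvent `w = u + Q^ψ w` of the killed chain
yields `v = 1 - w` with `Qv ≤ φ(v - 1_{>k})` and `νv` nearly at most `ν(>k)`
(`exists_superharmonic`). The environment is sampled at multiples of `h`, and Poisson points in each
time slab are retained according to the state at its right end. This is a chain with independent
killing, for which `v` is superharmonic up to `O(h²)` per step (`tsum_qSemigroup_thinned_le`,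
`measure_killedIn_le`), so the error up to time `T` is `O(Th)`. Right-continuity and local
finiteness of the points let `h → 0`. Finiteness of `τ₁` follows from `P(τ₁ = ∞) ≤ ν(>N) +
e^{-φ(N)T}`, with `T → ∞` and then `N → ∞`. -/

noncomputable section

/-! ### Birth-and-death generators and killed chains -/

/-- The death rate of a birth-and-death chain, with the convention that there is none at `0`. -/
def deathRate (d : ℕ → ℝ) (i : ℕ) : ℝ := if i = 0 then 0 else d i

/-- The generator of the birth-and-death chain with rates `b`, `d`, acting on functions. -/
def bdDrift (b d x : ℕ → ℝ) (i : ℕ) : ℝ :=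
  b i * (x (i + 1) - x i) + deathRate d i * (x (i - 1) - x i)

@[simp] lemma deathRate_zero (d : ℕ → ℝ) : deathRate d 0 = 0 := by simp [deathRate]

@[simp] lemma deathRate_succ (d : ℕ → ℝ) (i : ℕ) : deathRate d (i + 1) = d (i + 1) := by
  simp [deathRate]

lemma deathRate_nonneg {d : ℕ → ℝ} (hd : ∀ n, 1 ≤ n → 0 ≤ d n) (i : ℕ) : 0 ≤ deathRate d i := by
  rcases i with _ | i
  · simp
  · simpa using hd (i + 1) (by omega)

/-- Summation by parts: the pairing of the generator with a monotone density, applied to an antitone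
function, is bounded below by the flux through the boundary. -/
lemma sum_mul_bdDrift_ge {b d π g x : ℕ → ℝ} (hb : ∀ n, 0 ≤ b n) (hπ : ∀ n, 0 ≤ π n)
    (hrev : ∀ n, π n * b n = π (n + 1) * d (n + 1)) (hg : Monotone g)
    (hx : Antitone x) (N : ℕ) :
    -(g N * (π N * b N) * (x N - x (N + 1))) ≤
      ∑ i ∈ Finset.range (N + 1), g i * π i * bdDrift b d x i := by
  induction N with
  | zero => simp only [zero_add, Finset.range_one, Finset.sum_singleton, bdDrift, deathRate_zero]
            apply le_of_eq; ring
  | succ N ih =>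
    rw [Finset.sum_range_succ]
    -- By reversibility the old boundary flux reappears with weight `g (N + 1)` in place of `g N`.
    -- The excess is nonnegative.
    have h1 : g (N + 1) * π (N + 1) * bdDrift b d x (N + 1) =
        g (N + 1) * (π N * b N) * (x N - x (N + 1)) -
          g (N + 1) * (π (N + 1) * b (N + 1)) * (x (N + 1) - x (N + 1 + 1)) := by
      rw [hrev N]; simp only [bdDrift, deathRate_succ, Nat.add_sub_cancel]; ring
    have h2 : 0 ≤ (g (N + 1) - g N) * ((π N * b N) * (x N - x (N + 1))) :=
      mul_nonneg (sub_nonneg.2 (hg (Nat.le_succ N)))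
        (mul_nonneg (mul_nonneg (hπ N) (hb N)) (sub_nonneg.2 (hx (Nat.le_succ N))))
    rw [h1]
    nlinarith

/-- Powers of the uniformized transition matrix of the chain killed on reaching `N`. -/
def killedIter (b d u : ℕ → ℝ) (N : ℕ) (lam : ℝ) : ℕ → ℕ → ℝ
  | 0, i => if i < N then u i else 0
  | n + 1, i => if i < N then
      killedIter b d u N lam n i + bdDrift b d (killedIter b d u N lam n) i / lam else 0

/-! ### Uniformization, resolvent and semigroup of the killed chain -/

section Killed

variable {b d u : ℕ → ℝ} {N : ℕ} {lam : ℝ}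

lemma killedIter_of_le (n : ℕ) {i : ℕ} (hi : N ≤ i) : killedIter b d u N lam n i = 0 := by
  cases n <;> simp [killedIter, hi]

/-- Each uniformized step is a substochastic and stochastically monotone kernel. Bounding each rate
by `lam / 2` controls both `b i + d i` (positivity) and `b i + d (i + 1)` (monotonicity). -/
lemma killedIter_properties (hlam : 0 < lam) (hb : ∀ n, 0 ≤ b n) (hd : ∀ n, 1 ≤ n → 0 ≤ d n)
    (hbl : ∀ i ≤ N, b i ≤ lam / 2) (hdl : ∀ i ≤ N, deathRate d i ≤ lam / 2)
    (hu0 : ∀ i, 0 ≤ u i) (hu1 : ∀ i, u i ≤ 1) (hu : Antitone u) (n : ℕ) :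
    (∀ i, 0 ≤ killedIter b d u N lam n i) ∧ (∀ i, killedIter b d u N lam n i ≤ 1) ∧
      Antitone (killedIter b d u N lam n) := by
  induction n with
  | zero =>
    refine ⟨fun i => ?_, fun i => ?_, antitone_nat_of_succ_le fun i => ?_⟩
    · simp only [killedIter]; split_ifs; exacts [hu0 i, le_rfl]
    · simp only [killedIter]; split_ifs; exacts [hu1 i, zero_le_one]
    · simp only [killedIter]
      split_ifs
      exacts [hu (Nat.le_succ i), by omega, hu0 i, le_rfl]
  | succ n ih =>
    obtain ⟨h0, h1, ha⟩ := ih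
    set a := killedIter b d u N lam n with had
    have hstep : ∀ i, killedIter b d u N lam (n + 1) i =
        if i < N then a i + bdDrift b d a i / lam else 0 := fun i => rfl
    have hform : ∀ i, a i + bdDrift b d a i / lam = (1 - b i / lam - deathRate d i / lam) * a i
        + b i / lam * a (i + 1) + deathRate d i / lam * a (i - 1) := fun i => by
      simp only [bdDrift]; ring
    have hb0 : ∀ i, 0 ≤ b i / lam := fun i => div_nonneg (hb i) hlam.le
    have hd0 : ∀ i, 0 ≤ deathRate d i / lam := fun i => div_nonneg (deathRate_nonneg hd i) hlam.le
    have hb2 : ∀ i ≤ N, b i / lam ≤ 1 / 2 := fun i hi => by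
      rw [div_le_iff₀ hlam]; linarith [hbl i hi]
    have hd2 : ∀ i ≤ N, deathRate d i / lam ≤ 1 / 2 := fun i hi => by
      rw [div_le_iff₀ hlam]; linarith [hdl i hi]
    have hnn : ∀ i < N, 0 ≤ a i + bdDrift b d a i / lam := fun i hi => by
      rw [hform]
      have := hb2 i hi.le; have := hd2 i hi.le
      have h3 := mul_nonneg (hb0 i) (h0 (i + 1))
      have h4 := mul_nonneg (hd0 i) (h0 (i - 1))
      have h5 : 0 ≤ (1 - b i / lam - deathRate d i / lam) * a i :=
        mul_nonneg (by linarith) (h0 i)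
      linarith
    refine ⟨fun i => ?_, fun i => ?_, antitone_nat_of_succ_le fun i => ?_⟩
    · rw [hstep]; split_ifs with hi
      exacts [hnn i hi, le_rfl]
    · rw [hstep]; split_ifs with hi
      · rw [hform]
        have := hb2 i hi.le; have := hd2 i hi.le
        have h3 := mul_le_mul_of_nonneg_left (h1 (i + 1)) (hb0 i)
        have h4 := mul_le_mul_of_nonneg_left (h1 (i - 1)) (hd0 i)
        have h5 : (1 - b i / lam - deathRate d i / lam) * a i ≤
          (1 - b i / lam - deathRate d i / lam) * 1 :=
          mul_le_mul_of_nonneg_left (h1 i) (by linarith)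
        linarith
      · exact zero_le_one
    · rw [hstep, hstep]
      by_cases hi : i + 1 < N
      · rw [if_pos hi, if_pos (by omega), hform, hform]
        have e1 := hb2 i (by omega); have e2 := hd2 (i + 1) hi.le
        -- The new difference between `i` and `i + 1` is a combination of three old consecutive
        -- differences with nonnegative coefficients, namely the terms `h3`, `h4`, `h5`.
        have h3 : 0 ≤ (1 - b i / lam - deathRate d (i + 1) / lam) * (a i - a (i + 1)) :=
          mul_nonneg (by linarith) (sub_nonneg.2 (ha (Nat.le_succ i)))
        have h4 := mul_nonneg (hb0 (i + 1)) (sub_nonneg.2 (ha (Nat.le_succ (i + 1))))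
        have h5 := mul_nonneg (hd0 i) (sub_nonneg.2 (ha (Nat.sub_le i 1)))
        simp only [Nat.succ_eq_add_one, Nat.add_sub_cancel] at *
        nlinarith
      · rw [if_neg hi]
        split_ifs with hi'
        exacts [hnn i hi', le_rfl]

/-- A constant dominating the rates on `{0, …, N}`. -/
lemma exists_rate_bound (hb : ∀ n, 0 ≤ b n) (hd : ∀ n, 1 ≤ n → 0 ≤ d n) (N : ℕ) :
    ∃ lam : ℝ, 0 < lam ∧ (∀ i ≤ N, b i ≤ lam / 2) ∧ ∀ i ≤ N, deathRate d i ≤ lam / 2 := by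
  have hd' := deathRate_nonneg hd
  have hs : ∀ i ∈ Finset.range (N + 1), 0 ≤ b i + deathRate d i := fun i _ =>
    add_nonneg (hb i) (hd' i)
  have h0 := Finset.sum_nonneg hs
  refine ⟨2 * ((∑ i ∈ Finset.range (N + 1), (b i + deathRate d i)) + 1), by linarith,
    fun i hi => ?_, fun i hi => ?_⟩ <;>
  · have := Finset.single_le_sum hs (Finset.mem_range.2 (Nat.lt_succ_of_le hi))
    linarith [hb i, hd' i]

lemma hasSum_mul_bdDrift {a : ℕ → ℕ → ℝ} {c W : ℕ → ℝ}
    (h : ∀ j, HasSum (fun n => c n * a n j) (W j)) (i : ℕ) :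
    HasSum (fun n => c n * (a n i + bdDrift b d (a n) i / lam)) (W i + bdDrift b d W i / lam) := by
  have h1 := (h i).add (((((h (i + 1)).sub (h i)).mul_left (b i)).add
    (((h (i - 1)).sub (h i)).mul_left (deathRate d i))).div_const lam)
  convert h1 using 2 with n
  · simp only [bdDrift]
    ring
  · rfl

/-- The resolvent of the killed chain applied to an antitone function. -/
theorem exists_killed_resolvent (hb : ∀ n, 0 ≤ b n) (hd : ∀ n, 1 ≤ n → 0 ≤ d n)
    (hu0 : ∀ i, 0 ≤ u i) (hu1 : ∀ i, u i ≤ 1) (hu : Antitone u) (N : ℕ) :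
    ∃ w : ℕ → ℝ, (∀ i, 0 ≤ w i) ∧ (∀ i, w i ≤ 1) ∧ Antitone w ∧ (∀ i, N ≤ i → w i = 0) ∧
      ∀ i < N, w i = u i + bdDrift b d w i := by
  obtain ⟨lam, hlam, hbl, hdl⟩ := exists_rate_bound hb hd N
  have key := killedIter_properties hlam hb hd hbl hdl hu0 hu1 hu
  set a := killedIter b d u N lam with had
  -- Probability that a clock of rate `lam` rings before one of rate `1`. The resolvent at `1`
  -- averages the uniformized steps over a geometric number with this parameter.
  set r : ℝ := lam / (1 + lam) with hr
  have hr0 : 0 ≤ r := by positivity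
  have hr1 : r < 1 := by rw [hr, div_lt_one (by linarith)]; linarith
  have hsum : ∀ i, Summable fun n => r ^ n * a n i := fun i =>
    Summable.of_nonneg_of_le (fun n => mul_nonneg (pow_nonneg hr0 n) ((key _).1 i))
      (fun n => mul_le_of_le_one_right (pow_nonneg hr0 n) ((key _).2.1 i))
      (summable_geometric_of_lt_one hr0 hr1)
  have h1r : 1 - r = 1 / (1 + lam) := by rw [hr]; field_simp; ring
  refine ⟨fun i => (1 - r) * ∑' n, r ^ n * a n i, fun i => ?_, fun i => ?_, fun i j hij => ?_,
    fun i hi => ?_, fun i hi => ?_⟩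
  · exact mul_nonneg (by linarith) (tsum_nonneg fun n =>
      mul_nonneg (pow_nonneg hr0 n) ((key n).1 i))
  · have : ∑' n, r ^ n * a n i ≤ ∑' n, r ^ n := (hsum i).tsum_le_tsum
      (fun n => mul_le_of_le_one_right (pow_nonneg hr0 n) ((key _).2.1 i))
      (summable_geometric_of_lt_one hr0 hr1)
    rw [tsum_geometric_of_lt_one hr0 hr1] at this
    calc _ ≤ (1 - r) * (1 - r)⁻¹ := mul_le_mul_of_nonneg_left this (by linarith)
      _ = 1 := mul_inv_cancel₀ (by linarith)
  · exact mul_le_mul_of_nonneg_left ((hsum j).tsum_le_tsum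
      (fun n => mul_le_mul_of_nonneg_left ((key n).2.2 hij) (pow_nonneg hr0 n)) (hsum i))
      (by linarith)
  · simp [had, killedIter_of_le _ hi]
  · set W : ℕ → ℝ := fun j => ∑' n, r ^ n * a n j with hW
    have hdr := hasSum_mul_bdDrift (lam := lam) (b := b) (d := d) (c := fun n => r ^ n)
      (W := W) (fun j => (hsum j).hasSum) i
    have hstep : ∀ n, a (n + 1) i = a n i + bdDrift b d (a n) i / lam := fun n => by
      simp [had, killedIter, hi]
    have h0 : a 0 i = u i := by simp [had, killedIter, hi]
    simp only [← hstep] at hdr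
    have hW1 : W i = u i + r * (W i + bdDrift b d W i / lam) := by
      conv_lhs => rw [hW]
      simp only
      rw [Summable.tsum_eq_zero_add (hsum i), ← hdr.tsum_eq, ← tsum_mul_left]
      simp [h0, pow_succ', mul_assoc]
    have hdrift : bdDrift b d (fun i => (1 - r) * W i) i = (1 - r) * bdDrift b d W i := by
      simp only [bdDrift]; ring
    change (1 - r) * W i = u i + bdDrift b d (fun i => (1 - r) * W i) i
    rw [hdrift]
    have hlam' : (1 - r) * bdDrift b d W i = r * (bdDrift b d W i / lam) := by
      rw [h1r, hr]; field_simp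
    linarith

/-- Termwise differentiation, dominated on a ball containing `0` and `t` by the exponential series
at its radius; the derivative shifts the coefficients. -/
lemma hasDerivAt_expSeries {a : ℕ → ℝ} (ha : ∀ n, |a n| ≤ 1) (t : ℝ) :
    HasDerivAt (fun t : ℝ => ∑' n, t ^ n / n.factorial * a n)
      (∑' n, t ^ n / n.factorial * a (n + 1)) t := by
  set R : ℝ := |t| + 1 with hR
  have hR0 : 0 ≤ R := by positivity
  have hsum : Summable fun n : ℕ => (n : ℝ) * R ^ (n - 1) / n.factorial := by
    rw [← summable_nat_add_iff 1]
    refine (Real.summable_pow_div_factorial R).congr fun n => ?_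
    rw [Nat.factorial_succ]; push_cast
    rw [mul_div_mul_left _ _ (by positivity)]
  have h := hasDerivAt_tsum_of_isPreconnected (𝕜 := ℝ) (F := ℝ) (t := Metric.ball 0 R) (y₀ := 0)
    (g := fun n (y : ℝ) => y ^ n / n.factorial * a n)
    (g' := fun n (y : ℝ) => (n : ℝ) * y ^ (n - 1) / n.factorial * a n) (y := t) hsum
    Metric.isOpen_ball (convex_ball _ _).isPreconnected
    (fun n y _ => ((hasDerivAt_pow n y).div_const _).mul_const _)
    (fun n y hy => ?_) (by simp [hR]; positivity) ?_ (by simp [hR])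
  · have h' : Summable fun n : ℕ => (n : ℝ) * t ^ (n - 1) / n.factorial * a n := by
      refine Summable.of_norm_bounded hsum fun n => ?_
      rw [norm_mul, norm_div, norm_mul, norm_pow]
      simp only [Real.norm_eq_abs, abs_of_nonneg (Nat.cast_nonneg (α := ℝ) _)]
      refine (mul_le_of_le_one_right (by positivity) (ha n)).trans ?_
      gcongr
      simp [hR]
    rw [h'.tsum_eq_zero_add] at h
    refine h.congr_deriv ?_
    simp only [Nat.cast_zero, zero_mul, zero_div, zero_add]
    refine tsum_congr fun n => ?_
    rw [Nat.factorial_succ]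
    push_cast
    rw [mul_div_mul_left _ _ (by positivity)]
  · rw [norm_mul, norm_div, norm_mul, norm_pow]
    simp only [Real.norm_eq_abs, abs_of_nonneg (Nat.cast_nonneg (α := ℝ) _)]
    have hy' : |y| ≤ R := by simpa using (Metric.mem_ball.1 hy).le
    refine (mul_le_of_le_one_right (by positivity) (ha n)).trans ?_
    gcongr
  · exact summable_of_ne_finset_zero (s := {0}) fun n hn => by
      simp only [Finset.mem_singleton] at hn
      simp [hn]

/-- The semigroup of the killed chain applied to an antitone function. -/
theorem exists_killed_semigroup (hb : ∀ n, 0 ≤ b n) (hd : ∀ n, 1 ≤ n → 0 ≤ d n)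
    (hu0 : ∀ i, 0 ≤ u i) (hu1 : ∀ i, u i ≤ 1) (hu : Antitone u) (N : ℕ) :
    ∃ H : ℝ → ℕ → ℝ, (∀ t, 0 ≤ t → ∀ i, 0 ≤ H t i) ∧ (∀ t, 0 ≤ t → ∀ i, H t i ≤ 1) ∧
      (∀ t, 0 ≤ t → Antitone (H t)) ∧ (∀ t i, N ≤ i → H t i = 0) ∧ (∀ i < N, H 0 i = u i) ∧
      ∀ i < N, ∀ t, HasDerivAt (fun t => H t i) (bdDrift b d (H t) i) t := by
  obtain ⟨lam, hlam, hbl, hdl⟩ := exists_rate_bound hb hd N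
  have key := killedIter_properties hlam hb hd hbl hdl hu0 hu1 hu
  set a := killedIter b d u N lam with had
  have habs : ∀ n i, |a n i| ≤ 1 := fun n i => by
    rw [abs_of_nonneg ((key n).1 i)]; exact (key n).2.1 i
  have hsum : ∀ (t : ℝ) i, Summable fun n : ℕ => t ^ n / n.factorial * a n i :=
    fun t i => Summable.of_norm_bounded (Real.summable_pow_div_factorial t).norm fun n => by
      rw [norm_mul]; exact mul_le_of_le_one_right (norm_nonneg _) (habs _ i)
  set E : ℝ → ℕ → ℝ := fun t i => ∑' n : ℕ, t ^ n / n.factorial * a n i with hE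
  have hexp : ∀ t : ℝ, ∑' n : ℕ, t ^ n / n.factorial = Real.exp t := fun t => by
    rw [Real.exp_eq_exp_ℝ, NormedSpace.exp_eq_tsum_div]
  -- The uniformized steps are averaged over a Poisson number of parameter `lam * t`.
  refine ⟨fun t i => Real.exp (-(lam * t)) * E (lam * t) i, fun t ht i => ?_, fun t ht i => ?_,
    fun t ht i j hij => ?_, fun t i hi => ?_, fun i hi => ?_, fun i hi t => ?_⟩
  · have hlt : 0 ≤ lam * t := mul_nonneg hlam.le ht
    exact mul_nonneg (Real.exp_pos _).le (tsum_nonneg fun n =>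
      mul_nonneg (by positivity) ((key n).1 i))
  · have hlt : 0 ≤ lam * t := mul_nonneg hlam.le ht
    have : E (lam * t) i ≤ Real.exp (lam * t) := by
      rw [← hexp]
      exact (hsum _ i).tsum_le_tsum (fun n => mul_le_of_le_one_right (by positivity)
        ((key n).2.1 i)) (Real.summable_pow_div_factorial _)
    calc _ ≤ Real.exp (-(lam * t)) * Real.exp (lam * t) :=
          mul_le_mul_of_nonneg_left this (Real.exp_pos _).le
      _ = 1 := by rw [← Real.exp_add]; simp
  · have hlt : 0 ≤ lam * t := mul_nonneg hlam.le ht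
    exact mul_le_mul_of_nonneg_left ((hsum _ j).tsum_le_tsum
      (fun n => mul_le_mul_of_nonneg_left ((key n).2.2 hij) (by positivity)) (hsum _ i))
      (Real.exp_pos _).le
  · simp [hE, had, killedIter_of_le _ hi]
  · have : E 0 i = a 0 i := by
      simp only [hE]
      rw [tsum_eq_single 0 fun n hn => by simp [hn]]
      simp
    simp [this, had, killedIter, hi]
  · have hdr := hasSum_mul_bdDrift (lam := lam) (b := b) (d := d)
      (c := fun n : ℕ => (lam * t) ^ n / n.factorial) (W := E (lam * t))
      (fun j => (hsum _ j).hasSum) i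
    have hstep : ∀ n, a (n + 1) i = a n i + bdDrift b d (a n) i / lam := fun n => by
      simp [had, killedIter, hi]
    simp only [← hstep] at hdr
    have hmul : HasDerivAt (fun t : ℝ => lam * t) lam t := by
      simpa using (hasDerivAt_id t).const_mul lam
    have h1 := (hasDerivAt_expSeries (fun n => habs n i) (lam * t)).comp t hmul
    have h2 := (hmul.neg.exp).mul h1
    refine h2.congr_deriv ?_
    rw [hdr.tsum_eq]
    simp only [bdDrift, Function.comp, hE, Pi.neg_apply]
    field_simp
    ring

end Killed

/-! ### The semigroup of a birth-and-death generator acting on functions -/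

lemma measurable_semigroupIter (Q : ℕ → ℕ → ℝ) (k i j : ℕ) :
    Measurable fun t => semigroupIter Q k t i j := by
  induction k generalizing i with
  | zero => simp only [semigroupIter]; exact measurable_const
  | succ k ih =>
    simp only [semigroupIter]
    refine Measurable.add (by split_ifs <;> fun_prop) ?_
    have hset : MeasurableSet {x : ℝ × ℝ | x.2 ∈ Icc 0 x.1} :=
      (measurableSet_le measurable_const measurable_snd).inter
        (measurableSet_le measurable_snd measurable_fst)
    have hf : Measurable fun x : ℝ × ℝ => ENNReal.ofReal (Real.exp (Q i i * x.2)) *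
        ∑' m, if m = i then 0 else ENNReal.ofReal (Q i m) * semigroupIter Q k (x.1 - x.2) m j := by
      refine Measurable.mul (by fun_prop) (Measurable.tsum fun m => ?_)
      split_ifs
      · exact measurable_const
      · exact ((ih m).comp (measurable_fst.sub measurable_snd)).const_mul _
    have h := (hf.indicator hset).lintegral_prod_right' (ν := volume)
    convert h using 2 with t
    rw [← lintegral_indicator measurableSet_Icc]
    rfl

lemma semigroupIter_mono (Q : ℕ → ℕ → ℝ) (i j : ℕ) (t : ℝ) :
    Monotone fun k => semigroupIter Q k t i j := by
  refine monotone_nat_of_le_succ fun k => ?_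
  induction k generalizing i t with
  | zero => simp [semigroupIter]
  | succ k ih =>
    rw [semigroupIter, semigroupIter]
    gcongr with s m
    split_ifs
    · exact le_rfl
    · gcongr
      exact ih m (t - s)

lemma bdGenerator_self (b d : ℕ → ℝ) (i : ℕ) : bdGenerator b d i i = -(b i + deathRate d i) := by
  simp [bdGenerator, deathRate]

/-- At `i = 0` the truncated `i - 1 = 0` is harmless, since `deathRate d 0 = 0`. -/
lemma tsum_bdGenerator_offDiag (b d : ℕ → ℝ) (x : ℕ → ℝ≥0∞) (i : ℕ) :
    (∑' m, if m = i then 0 else ENNReal.ofReal (bdGenerator b d i m) * x m) =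
      ENNReal.ofReal (b i) * x (i + 1) + ENNReal.ofReal (deathRate d i) * x (i - 1) := by
  rw [tsum_eq_sum (s := {i + 1, i - 1}) fun m hm => ?_]
  · rw [Finset.sum_pair (by omega)]
    rcases i with _ | i
    · simp [bdGenerator]
    · have : i ≠ i + 1 + 1 := by omega
      simp [bdGenerator, this]
  · simp only [Finset.mem_insert, Finset.mem_singleton, not_or] at hm
    split_ifs with h
    · rfl
    · have : bdGenerator b d i m = 0 := by
        unfold bdGenerator
        rw [if_neg hm.1, if_neg (by omega), if_neg h]
      simp [this]

/-- The Picard iterates of the backward equation, applied to a nonnegative function. -/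
def bdIter (b d : ℕ → ℝ) (u : ℕ → ℝ≥0∞) (k : ℕ) (t : ℝ) (i : ℕ) : ℝ≥0∞ :=
  ∑' j, semigroupIter (bdGenerator b d) k t i j * u j

section Iter

variable {b d : ℕ → ℝ} {u : ℕ → ℝ≥0∞}

lemma bdIter_zero (t : ℝ) (i : ℕ) : bdIter b d u 0 t i = 0 := by simp [bdIter, semigroupIter]

lemma bdIter_succ (k : ℕ) (t : ℝ) (i : ℕ) :
    bdIter b d u (k + 1) t i =
      ENNReal.ofReal (Real.exp (-(b i + deathRate d i) * t)) * u i +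
        ∫⁻ s in Icc 0 t, ENNReal.ofReal (Real.exp (-(b i + deathRate d i) * s)) *
          (ENNReal.ofReal (b i) * bdIter b d u k (t - s) (i + 1) +
            ENNReal.ofReal (deathRate d i) * bdIter b d u k (t - s) (i - 1)) := by
  have hm : ∀ m j, Measurable fun s : ℝ => semigroupIter (bdGenerator b d) k (t - s) m j :=
    fun m j => (measurable_semigroupIter _ k m j).comp (measurable_const.sub measurable_id)
  unfold bdIter
  simp only [semigroupIter, tsum_bdGenerator_offDiag, bdGenerator_self, add_mul]
  rw [ENNReal.tsum_add]
  congr 1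
  · rw [tsum_eq_single i fun j hj => by simp [hj.symm]]
    simp
  · simp_rw [← ENNReal.tsum_mul_left, ← ENNReal.tsum_add, ← ENNReal.tsum_mul_left]
    rw [lintegral_tsum fun j => by fun_prop]
    refine tsum_congr fun j => ?_
    rw [← lintegral_mul_const _ (by fun_prop)]
    refine lintegral_congr fun s => ?_
    ring

/-- Monotone convergence for the counting measure. -/
lemma tsum_qSemigroup_mul (Q : ℕ → ℕ → ℝ) (t : ℝ≥0) (i : ℕ) (u : ℕ → ℝ≥0∞) :
    ∑' j, qSemigroup Q t i j * u j = ⨆ k, ∑' j, semigroupIter Q k t i j * u j := by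
  simp only [qSemigroup]
  simp_rw [ENNReal.iSup_mul, ← lintegral_count]
  exact lintegral_iSup (fun k => measurable_of_countable _) fun _ _ h j =>
    mul_le_mul_left (semigroupIter_mono Q i j t h) _

lemma tsum_qSemigroup_bd (t : ℝ≥0) (i : ℕ) :
    ∑' j, qSemigroup (bdGenerator b d) t i j * u j = ⨆ k, bdIter b d u k t i :=
  tsum_qSemigroup_mul _ t i u

lemma lintegral_exp_rate {q : ℝ} (hq : 0 ≤ q) {t : ℝ} (ht : 0 ≤ t) :
    ∫⁻ s in Icc 0 t, ENNReal.ofReal (Real.exp (-q * s)) * ENNReal.ofReal q =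
      ENNReal.ofReal (1 - Real.exp (-q * t)) := by
  have h1 : ∫ s in (0 : ℝ)..t, Real.exp (-q * s) * q = 1 - Real.exp (-q * t) := by
    have hd : ∀ s ∈ uIcc 0 t, HasDerivAt (fun s => -Real.exp (-q * s)) (Real.exp (-q * s) * q) s :=
      fun s _ => by
        have := (((hasDerivAt_id s).const_mul (-q)).exp).neg
        refine this.congr_deriv ?_
        simp
    rw [intervalIntegral.integral_eq_sub_of_hasDerivAt hd
      (Continuous.intervalIntegrable (by fun_prop) _ _)]
    simp; ring
  rw [intervalIntegral.integral_of_le ht, ← integral_Icc_eq_integral_Ioc] at h1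
  rw [← h1, ofReal_integral_eq_lintegral_ofReal]
  · refine lintegral_congr fun s => ?_
    rw [ENNReal.ofReal_mul (Real.exp_pos _).le]
  · exact (Continuous.integrableOn_Icc (by fun_prop))
  · exact Eventually.of_forall fun s => mul_nonneg (Real.exp_pos _).le hq

/-- The chances of no jump before `t` and of a first jump before `t` add up to one. -/
lemma bdIter_le_one (hb : ∀ n, 0 ≤ b n) (hd : ∀ n, 1 ≤ n → 0 ≤ d n) (hu : ∀ i, u i ≤ 1)
    (k : ℕ) {t : ℝ} (ht : 0 ≤ t) (i : ℕ) : bdIter b d u k t i ≤ 1 := by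
  induction k generalizing t i with
  | zero => simp [bdIter_zero]
  | succ k ih =>
    have hd' := deathRate_nonneg hd i
    rw [bdIter_succ]
    calc _ ≤ ENNReal.ofReal (Real.exp (-(b i + deathRate d i) * t)) * 1 +
        ∫⁻ s in Icc 0 t, ENNReal.ofReal (Real.exp (-(b i + deathRate d i) * s)) *
          ENNReal.ofReal (b i + deathRate d i) := by
          refine add_le_add (mul_le_mul_right (hu i) _) ?_
          refine setLIntegral_mono' measurableSet_Icc fun s hs => ?_
          rw [ENNReal.ofReal_add (hb i) hd']
          gcongr
          · exact mul_le_of_le_one_right' (ih (by linarith [hs.2]) _)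
          · exact mul_le_of_le_one_right' (ih (by linarith [hs.2]) _)
      _ = 1 := by
          rw [lintegral_exp_rate (add_nonneg (hb i) hd') ht, mul_one,
            ← ENNReal.ofReal_add (Real.exp_pos _).le]
          · simp
          · rw [sub_nonneg, Real.exp_le_one_iff]
            nlinarith [add_nonneg (hb i) hd']

end Iter

/-! ### Comparison of the killed chain with the minimal semigroup -/

section LowerBound

variable {b d u : ℕ → ℝ} {N : ℕ} {H : ℝ → ℕ → ℝ}

/-- Duhamel's formula puts the killed semigroup in the integrated form used by the Picard iterates.
It comes from integrating the derivative of `-e^{-(b i + d i)s} H (t - s) i` over `[0, t]`. -/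
lemma killed_variation_of_constants (hHN : ∀ t i, N ≤ i → H t i = 0) (hH0 : ∀ i < N, H 0 i = u i)
    (hH' : ∀ i < N, ∀ t, HasDerivAt (fun t => H t i) (bdDrift b d (H t) i) t) {t : ℝ} (ht : 0 ≤ t)
    {i : ℕ} (hi : i < N) :
    Continuous (fun s => Real.exp (-(b i + deathRate d i) * s) *
      (b i * H (t - s) (i + 1) + deathRate d i * H (t - s) (i - 1))) ∧
    H t i = Real.exp (-(b i + deathRate d i) * t) * u i +
      ∫ s in Icc 0 t, Real.exp (-(b i + deathRate d i) * s) *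
        (b i * H (t - s) (i + 1) + deathRate d i * H (t - s) (i - 1)) := by
  have hcont : ∀ j, Continuous fun s => H s j := fun j => by
    by_cases hj : j < N
    · exact continuous_iff_continuousAt.2 fun s => (hH' j hj s).continuousAt
    · simp_rw [hHN _ j (not_lt.1 hj)]; exact continuous_const
  have hcont' : ∀ j, Continuous fun s => H (t - s) j := fun j =>
    (hcont j).comp (continuous_const.sub continuous_id)
  have hc : Continuous (fun s => Real.exp (-(b i + deathRate d i) * s) *
      (b i * H (t - s) (i + 1) + deathRate d i * H (t - s) (i - 1))) := by
    have := hcont' (i + 1)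
    have := hcont' (i - 1)
    fun_prop
  refine ⟨hc, ?_⟩
  have hd : ∀ s ∈ uIcc 0 t, HasDerivAt
      (fun s => -(Real.exp (-(b i + deathRate d i) * s) * H (t - s) i))
      (Real.exp (-(b i + deathRate d i) * s) *
        (b i * H (t - s) (i + 1) + deathRate d i * H (t - s) (i - 1))) s := fun s _ => by
    have h1 := ((hasDerivAt_id s).const_mul (-(b i + deathRate d i))).exp
    have h2 : HasDerivAt (fun s => t - s) (-1) s := by
      simpa using (hasDerivAt_id s).const_sub t
    have h3 := (hH' i hi (t - s)).comp s h2
    refine (h1.mul h3).neg.congr_deriv ?_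
    simp only [bdDrift, id, Function.comp]
    ring
  rw [integral_Icc_eq_integral_Ioc, ← intervalIntegral.integral_of_le ht,
    intervalIntegral.integral_eq_sub_of_hasDerivAt hd (hc.intervalIntegrable _ _)]
  simp [hH0 i hi]

lemma lintegral_mul_pow_div_factorial {L : ℝ} (hL : 0 ≤ L) (k : ℕ) {t : ℝ} (ht : 0 ≤ t) :
    ∫⁻ s in Icc 0 t, ENNReal.ofReal (L * ((L * (t - s)) ^ k / k.factorial)) =
      ENNReal.ofReal ((L * t) ^ (k + 1) / (k + 1).factorial) := by
  have h1 : ∫ s in (0 : ℝ)..t, L * ((L * (t - s)) ^ k / k.factorial) =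
      (L * t) ^ (k + 1) / (k + 1).factorial := by
    have hd : ∀ s ∈ uIcc 0 t, HasDerivAt
        (fun s => -((L * (t - s)) ^ (k + 1) / (k + 1).factorial))
        (L * ((L * (t - s)) ^ k / k.factorial)) s := fun s _ => by
      have h2 : HasDerivAt (fun s => L * (t - s)) (-L) s := by
        simpa using ((hasDerivAt_id s).const_sub t).const_mul L
      refine ((h2.pow (k + 1)).div_const _).neg.congr_deriv ?_
      rw [Nat.factorial_succ]
      push_cast
      have : (k.factorial : ℝ) ≠ 0 := by positivity
      field_simp
    rw [intervalIntegral.integral_eq_sub_of_hasDerivAt hd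
      (Continuous.intervalIntegrable (by fun_prop) _ _)]
    simp
  rw [← h1, intervalIntegral.integral_of_le ht, ← integral_Icc_eq_integral_Ioc,
    ofReal_integral_eq_lintegral_ofReal]
  · exact Continuous.integrableOn_Icc (by fun_prop)
  · refine (ae_restrict_iff' measurableSet_Icc).2 (Eventually.of_forall fun s hs => ?_)
    have : 0 ≤ t - s := by linarith [hs.2]
    simp only [Pi.zero_apply]
    positivity

/-- The `k`-th iterate misses only paths with at least `k` jumps. With rates at most `L` below `N`,
these weigh at most `(L t)^k / k!`, a bound reproduced by the Duhamel recursion. As the error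
vanishes when `k → ∞`, no uniqueness for the backward equation is needed. -/
lemma killed_le_bdIter_add (hb : ∀ n, 0 ≤ b n) (hd : ∀ n, 1 ≤ n → 0 ≤ d n) (hu0 : ∀ i, 0 ≤ u i)
    (hnn : ∀ t, 0 ≤ t → ∀ i, 0 ≤ H t i) (hle : ∀ t, 0 ≤ t → ∀ i, H t i ≤ 1)
    (hHN : ∀ t i, N ≤ i → H t i = 0) (hH0 : ∀ i < N, H 0 i = u i)
    (hH' : ∀ i < N, ∀ t, HasDerivAt (fun t => H t i) (bdDrift b d (H t) i) t)
    {L : ℝ} (hL : 0 ≤ L) (hrate : ∀ i < N, b i + deathRate d i ≤ L)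
    (k : ℕ) {t : ℝ} (ht : 0 ≤ t) (i : ℕ) :
    ENNReal.ofReal (H t i) ≤ bdIter b d (fun j => ENNReal.ofReal (u j)) k t i +
      ENNReal.ofReal ((L * t) ^ k / k.factorial) := by
  induction k generalizing t i with
  | zero =>
    refine le_add_left ?_
    simpa using hle t ht i
  | succ k ih =>
    by_cases hi : i < N
    swap
    · simp [hHN t i (not_lt.1 hi)]
    have hd' := deathRate_nonneg hd i
    obtain ⟨hc, hv⟩ := killed_variation_of_constants hHN hH0 hH' ht hi
    have hint : 0 ≤ᵐ[volume.restrict (Icc 0 t)] fun s => Real.exp (-(b i + deathRate d i) * s) *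
        (b i * H (t - s) (i + 1) + deathRate d i * H (t - s) (i - 1)) := by
      refine (ae_restrict_iff' measurableSet_Icc).2 (Eventually.of_forall fun s hs => ?_)
      have hs' : 0 ≤ t - s := by linarith [hs.2]
      exact mul_nonneg (Real.exp_pos _).le (add_nonneg (mul_nonneg (hb i) (hnn _ hs' _))
        (mul_nonneg hd' (hnn _ hs' _)))
    rw [hv, ENNReal.ofReal_add (mul_nonneg (Real.exp_pos _).le (hu0 i)) (integral_nonneg_of_ae hint),
      ofReal_integral_eq_lintegral_ofReal hc.integrableOn_Icc hint, bdIter_succ, add_assoc,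
      ENNReal.ofReal_mul (Real.exp_pos _).le, ← lintegral_mul_pow_div_factorial hL k ht,
      ← lintegral_add_right _ (by fun_prop)]
    refine add_le_add le_rfl (setLIntegral_mono' measurableSet_Icc fun s hs => ?_)
    have hs' : 0 ≤ t - s := by linarith [hs.2]
    set e := ENNReal.ofReal ((L * (t - s)) ^ k / k.factorial) with he
    have hexp : ENNReal.ofReal (Real.exp (-(b i + deathRate d i) * s)) ≤ 1 := by
      rw [ENNReal.ofReal_le_one, Real.exp_le_one_iff]
      nlinarith [mul_nonneg (add_nonneg (hb i) hd') hs.1]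
    have hrt : ENNReal.ofReal (b i) + ENNReal.ofReal (deathRate d i) ≤ ENNReal.ofReal L := by
      rw [← ENNReal.ofReal_add (hb i) hd']
      exact ENNReal.ofReal_le_ofReal (hrate i hi)
    rw [ENNReal.ofReal_mul (Real.exp_pos _).le, ENNReal.ofReal_add (mul_nonneg (hb i) (hnn _ hs' _))
      (mul_nonneg hd' (hnn _ hs' _)), ENNReal.ofReal_mul (hb i), ENNReal.ofReal_mul hd',
      ENNReal.ofReal_mul hL, ← he]
    calc _ ≤ ENNReal.ofReal (Real.exp (-(b i + deathRate d i) * s)) *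
          (ENNReal.ofReal (b i) * (bdIter b d (fun j => ENNReal.ofReal (u j)) k (t - s) (i + 1) + e)
            + ENNReal.ofReal (deathRate d i) *
              (bdIter b d (fun j => ENNReal.ofReal (u j)) k (t - s) (i - 1) + e)) := by
          gcongr
          · exact ih hs' _
          · exact ih hs' _
      _ = ENNReal.ofReal (Real.exp (-(b i + deathRate d i) * s)) *
          (ENNReal.ofReal (b i) * bdIter b d (fun j => ENNReal.ofReal (u j)) k (t - s) (i + 1)
            + ENNReal.ofReal (deathRate d i) *
              bdIter b d (fun j => ENNReal.ofReal (u j)) k (t - s) (i - 1)) +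
          ENNReal.ofReal (Real.exp (-(b i + deathRate d i) * s)) *
            ((ENNReal.ofReal (b i) + ENNReal.ofReal (deathRate d i)) * e) := by ring
      _ ≤ _ := by
          exact add_le_add le_rfl ((mul_le_of_le_one_left' hexp).trans (mul_le_mul_left hrt _))

lemma killed_le_iSup_bdIter (hb : ∀ n, 0 ≤ b n) (hd : ∀ n, 1 ≤ n → 0 ≤ d n) (hu0 : ∀ i, 0 ≤ u i)
    (hnn : ∀ t, 0 ≤ t → ∀ i, 0 ≤ H t i) (hle : ∀ t, 0 ≤ t → ∀ i, H t i ≤ 1)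
    (hHN : ∀ t i, N ≤ i → H t i = 0) (hH0 : ∀ i < N, H 0 i = u i)
    (hH' : ∀ i < N, ∀ t, HasDerivAt (fun t => H t i) (bdDrift b d (H t) i) t)
    {t : ℝ} (ht : 0 ≤ t) (i : ℕ) :
    ENNReal.ofReal (H t i) ≤ ⨆ k, bdIter b d (fun j => ENNReal.ofReal (u j)) k t i := by
  obtain ⟨lam, hlam, hbl, hdl⟩ := exists_rate_bound hb hd N
  have h0 : Tendsto (fun k : ℕ => (⨆ k, bdIter b d (fun j => ENNReal.ofReal (u j)) k t i) +
      ENNReal.ofReal ((lam * t) ^ k / k.factorial)) atTop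
      (𝓝 ((⨆ k, bdIter b d (fun j => ENNReal.ofReal (u j)) k t i) + 0)) := by
    refine tendsto_const_nhds.add ?_
    have := ENNReal.tendsto_ofReal (FloorSemiring.tendsto_pow_div_factorial_atTop (lam * t))
    simpa using this
  rw [add_zero] at h0
  refine ge_of_tendsto' h0 fun k => ?_
  refine (killed_le_bdIter_add hb hd hu0 hnn hle hHN hH0 hH' hlam.le
    (fun i hi => by linarith [hbl i hi.le, hdl i hi.le]) k ht i).trans ?_
  gcongr
  exact le_iSup (fun k => bdIter b d (fun j => ENNReal.ofReal (u j)) k t i) k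

/-- Pairing the semigroup applied to an antitone function with a monotone bounded density with
respect to the reversible measure gives a quantity which does not decrease in time. -/
theorem ofReal_tsum_le_tsum_mul_iSup_bdIter {π g : ℕ → ℝ} {C : ℝ}
    (hb : ∀ n, 0 ≤ b n) (hd : ∀ n, 1 ≤ n → 0 ≤ d n)
    (hπ : ∀ n, 0 ≤ π n) (hπs : Summable π) (hrev : ∀ n, π n * b n = π (n + 1) * d (n + 1))
    (hflux : Tendsto (fun n => π n * b n) atTop (𝓝 0))
    (hg : Monotone g) (hg0 : ∀ n, 0 ≤ g n) (hgC : ∀ n, g n ≤ C)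
    (hu0 : ∀ i, 0 ≤ u i) (hu1 : ∀ i, u i ≤ 1) (hu : Antitone u) {t : ℝ} (ht : 0 ≤ t) :
    ENNReal.ofReal (∑' i, g i * π i * u i) ≤
      ∑' i, ENNReal.ofReal (g i * π i) *
        ⨆ k, bdIter b d (fun j => ENNReal.ofReal (u j)) k t i := by
  have hsum : Summable fun i => g i * π i * u i :=
    Summable.of_nonneg_of_le (fun i => mul_nonneg (mul_nonneg (hg0 i) (hπ i)) (hu0 i))
      (fun i => (mul_le_of_le_one_right (mul_nonneg (hg0 i) (hπ i)) (hu1 i)).trans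
        (mul_le_mul_of_nonneg_right (hgC i) (hπ i))) (hπs.mul_left C)
  have hlim : Tendsto (fun N => ENNReal.ofReal (∑ i ∈ Finset.range (N + 1), g i * π i * u i -
      C * (π N * b N) * t)) atTop (𝓝 (ENNReal.ofReal (∑' i, g i * π i * u i))) := by
    have h1 := (hsum.hasSum.tendsto_sum_nat.comp (tendsto_add_atTop_nat 1)).sub
      ((hflux.const_mul C).mul_const t)
    simp only [mul_zero, zero_mul, sub_zero] at h1
    exact ENNReal.tendsto_ofReal h1
  refine le_of_tendsto' hlim fun N => ?_
  -- Killing at `N + 1` matches the sum over `{0,…,N}`: the flux across the last edge is `g N π N b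
  -- N H s N`, which is at most `C π N b N`.
  obtain ⟨H, hnn, hle, hanti, hHN, hH0, hH'⟩ := exists_killed_semigroup hb hd hu0 hu1 hu (N + 1)
  have hΦ' : ∀ s, HasDerivAt (fun s => ∑ i ∈ Finset.range (N + 1), g i * π i * H s i)
      (∑ i ∈ Finset.range (N + 1), g i * π i * bdDrift b d (H s) i) s := fun s =>
    HasDerivAt.fun_sum fun i hi => (hH' i (Finset.mem_range.1 hi) s).const_mul _
  have hc0 : 0 ≤ C * (π N * b N) :=
    mul_nonneg ((hg0 0).trans (hgC 0)) (mul_nonneg (hπ N) (hb N))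
  have hge : ∀ s, 0 ≤ s → -(C * (π N * b N)) ≤
      ∑ i ∈ Finset.range (N + 1), g i * π i * bdDrift b d (H s) i := fun s hs => by
    refine le_trans ?_ (sum_mul_bdDrift_ge hb hπ hrev hg (hanti s hs) N)
    rw [neg_le_neg_iff, hHN s (N + 1) le_rfl, sub_zero]
    have hc := mul_nonneg (hπ N) (hb N)
    calc _ ≤ g N * (π N * b N) := mul_le_of_le_one_right (mul_nonneg (hg0 N) hc) (hle s hs N)
      _ ≤ _ := mul_le_mul_of_nonneg_right (hgC N) hc
  have hmv := (convex_Ici (0 : ℝ)).mul_sub_le_image_sub_of_le_deriv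
    (f := fun s => ∑ i ∈ Finset.range (N + 1), g i * π i * H s i) (C := -(C * (π N * b N)))
    (fun s _ => (hΦ' s).continuousAt.continuousWithinAt)
    (fun s _ => (hΦ' s).differentiableAt.differentiableWithinAt)
    (fun s hs => by
      rw [(hΦ' s).deriv]
      exact hge s (interior_subset hs)) 0 (mem_Ici.2 le_rfl) t (mem_Ici.2 ht) ht
  have hΦ0 : ∑ i ∈ Finset.range (N + 1), g i * π i * H 0 i =
      ∑ i ∈ Finset.range (N + 1), g i * π i * u i :=
    Finset.sum_congr rfl fun i hi => by rw [hH0 i (Finset.mem_range.1 hi)]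
  rw [hΦ0] at hmv
  calc _ ≤ ENNReal.ofReal (∑ i ∈ Finset.range (N + 1), g i * π i * H t i) :=
        ENNReal.ofReal_le_ofReal (by linarith)
    _ = ∑ i ∈ Finset.range (N + 1), ENNReal.ofReal (g i * π i) * ENNReal.ofReal (H t i) := by
        rw [ENNReal.ofReal_sum_of_nonneg fun i _ =>
          mul_nonneg (mul_nonneg (hg0 i) (hπ i)) (hnn t ht i)]
        exact Finset.sum_congr rfl fun i _ => ENNReal.ofReal_mul (mul_nonneg (hg0 i) (hπ i))
    _ ≤ ∑ i ∈ Finset.range (N + 1), ENNReal.ofReal (g i * π i) *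
          ⨆ k, bdIter b d (fun j => ENNReal.ofReal (u j)) k t i := by
        gcongr with i
        exact killed_le_iSup_bdIter hb hd hu0 hnn hle hHN hH0 hH' ht i
    _ ≤ _ := ENNReal.sum_le_tsum _

end LowerBound

/-! ### Short-time upper bounds for the semigroup -/

section ShortTime

variable {b d x : ℕ → ℝ}

/-- A jump before `t` has probability at most `t`. This crude bound is fed back into the recursion
to get the second-order one. -/
lemma bdIter_le_add_mul (hb : ∀ n, 0 ≤ b n) (hd : ∀ n, 1 ≤ n → 0 ≤ d n)
    (hrate : ∀ i, b i + deathRate d i ≤ 1) (hx0 : ∀ i, 0 ≤ x i) (hx1 : ∀ i, x i ≤ 1)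
    (k : ℕ) {t : ℝ} (ht : 0 ≤ t) (i : ℕ) :
    bdIter b d (fun j => ENNReal.ofReal (x j)) k t i ≤ ENNReal.ofReal (x i + t) := by
  cases k with
  | zero => simp [bdIter_zero]
  | succ k =>
    have hd' := deathRate_nonneg hd i
    have hone : ∀ {s : ℝ}, 0 ≤ s → ∀ j, bdIter b d (fun j => ENNReal.ofReal (x j)) k s j ≤ 1 :=
      fun hs j => bdIter_le_one hb hd (fun i => by simpa using hx1 i) k hs j
    have hexp : ∀ {s : ℝ}, 0 ≤ s →
        ENNReal.ofReal (Real.exp (-(b i + deathRate d i) * s)) ≤ 1 := fun hs => by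
      rw [ENNReal.ofReal_le_one, Real.exp_le_one_iff]
      nlinarith [mul_nonneg (add_nonneg (hb i) hd') hs]
    rw [bdIter_succ, ENNReal.ofReal_add (hx0 i) ht]
    refine add_le_add (mul_le_of_le_one_left' (hexp ht)) ?_
    calc _ ≤ ∫⁻ s in Icc 0 t, 1 := by
          refine setLIntegral_mono' measurableSet_Icc fun s hs => ?_
          refine (mul_le_of_le_one_left' (hexp hs.1)).trans ?_
          refine (add_le_add (mul_le_of_le_one_right' (hone (by linarith [hs.2]) _))
            (mul_le_of_le_one_right' (hone (by linarith [hs.2]) _))).trans ?_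
          rw [← ENNReal.ofReal_add (hb i) hd', ENNReal.ofReal_le_one]
          exact hrate i
      _ = _ := by simp

/-- First order expansion of the semigroup at time `0`, from above. -/
lemma bdIter_le_expansion (hb : ∀ n, 0 ≤ b n) (hd : ∀ n, 1 ≤ n → 0 ≤ d n)
    (hrate : ∀ i, b i + deathRate d i ≤ 1) (hx0 : ∀ i, 0 ≤ x i) (hx1 : ∀ i, x i ≤ 1)
    (k : ℕ) {t : ℝ} (ht : 0 ≤ t) (i : ℕ) :
    bdIter b d (fun j => ENNReal.ofReal (x j)) k t i ≤
      ENNReal.ofReal (x i + t * bdDrift b d x i + 2 * t ^ 2) := by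
  cases k with
  | zero => simp [bdIter_zero]
  | succ k =>
    have hd' := deathRate_nonneg hd i
    set q := b i + deathRate d i with hq
    have hq0 : 0 ≤ q := add_nonneg (hb i) hd'
    have hq1 : q ≤ 1 := hrate i
    have hI : ∫⁻ s in Icc 0 t, ENNReal.ofReal (Real.exp (-q * s)) *
        (ENNReal.ofReal (b i) * bdIter b d (fun j => ENNReal.ofReal (x j)) k (t - s) (i + 1) +
          ENNReal.ofReal (deathRate d i) *
            bdIter b d (fun j => ENNReal.ofReal (x j)) k (t - s) (i - 1)) ≤
        ENNReal.ofReal ((b i * (x (i + 1) + t) + deathRate d i * (x (i - 1) + t)) * t) := by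
      calc _ ≤ ∫⁻ s in Icc 0 t,
            ENNReal.ofReal (b i * (x (i + 1) + t) + deathRate d i * (x (i - 1) + t)) := by
            refine setLIntegral_mono' measurableSet_Icc fun s hs => ?_
            have hs' : 0 ≤ t - s := by linarith [hs.2]
            have hexp : ENNReal.ofReal (Real.exp (-q * s)) ≤ 1 := by
              rw [ENNReal.ofReal_le_one, Real.exp_le_one_iff]
              nlinarith [mul_nonneg hq0 hs.1]
            rw [ENNReal.ofReal_add (mul_nonneg (hb i) (add_nonneg (hx0 _) ht))
              (mul_nonneg hd' (add_nonneg (hx0 _) ht)), ENNReal.ofReal_mul (hb i),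
              ENNReal.ofReal_mul hd']
            refine (mul_le_of_le_one_left' hexp).trans ?_
            gcongr
            · exact (bdIter_le_add_mul hb hd hrate hx0 hx1 k hs' _).trans
                (ENNReal.ofReal_le_ofReal (by linarith [hs.1]))
            · exact (bdIter_le_add_mul hb hd hrate hx0 hx1 k hs' _).trans
                (ENNReal.ofReal_le_ofReal (by linarith [hs.1]))
        _ = _ := by
            rw [setLIntegral_const, Real.volume_Icc, sub_zero, ← ENNReal.ofReal_mul]
            exact add_nonneg (mul_nonneg (hb i) (add_nonneg (hx0 _) ht))
              (mul_nonneg hd' (add_nonneg (hx0 _) ht))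
    rw [bdIter_succ, ← hq]
    refine (add_le_add le_rfl hI).trans ?_
    rw [← ENNReal.ofReal_mul (Real.exp_pos _).le, ← ENNReal.ofReal_add
      (mul_nonneg (Real.exp_pos _).le (hx0 i)) (mul_nonneg (add_nonneg
        (mul_nonneg (hb i) (add_nonneg (hx0 _) ht)) (mul_nonneg hd' (add_nonneg (hx0 _) ht))) ht)]
    refine ENNReal.ofReal_le_ofReal ?_
    have hqt : 0 ≤ q * t := mul_nonneg hq0 ht
    -- With `y = q t`: `e^{-y} ≤ 1/(1 + y)` and `(1 + y)(1 - y + y²) = 1 + y³ ≥ 1`. This costs one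
    -- `t²`; the other comes from the added `t` in the integral.
    have hexp : Real.exp (-q * t) ≤ 1 - q * t + (q * t) ^ 2 := by
      have h1 : Real.exp (-q * t) * (1 + q * t) ≤ 1 := by
        calc _ ≤ Real.exp (-q * t) * Real.exp (q * t) :=
              mul_le_mul_of_nonneg_left (by linarith [Real.add_one_le_exp (q * t)])
                (Real.exp_pos _).le
          _ = 1 := by rw [← Real.exp_add]; simp
      nlinarith [Real.exp_pos (-q * t), pow_nonneg hqt 3]
    have hq2 : (q * t) ^ 2 ≤ t ^ 2 :=
      pow_le_pow_left₀ hqt (mul_le_of_le_one_left ht hq1) 2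
    have h2 : Real.exp (-q * t) * x i ≤ (1 - q * t) * x i + t ^ 2 := by
      have := mul_le_mul_of_nonneg_right hexp (hx0 i)
      nlinarith [mul_le_of_le_one_right (sq_nonneg (q * t)) (hx1 i)]
    have h3 : q * t ^ 2 ≤ t ^ 2 := mul_le_of_le_one_left (sq_nonneg t) hq1
    simp only [bdDrift]
    rw [hq] at h2 h3 ⊢
    nlinarith

end ShortTime

/-! ### The equilibrium distribution and the time-changed semigroup -/

lemma timeChanged_bdGenerator (p q φ : ℕ → ℝ) :
    timeChanged φ (bdGenerator p q) = bdGenerator (fun n => p n / φ n) (fun n => q n / φ n) := by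
  funext n m
  simp only [timeChanged, bdGenerator]
  split_ifs <;> ring

lemma timeChanged_one (Q : ℕ → ℕ → ℝ) : timeChanged (fun _ => 1) Q = Q := by
  funext n m; simp [timeChanged]

/-- The mass of `n` under the equilibrium distribution. -/
def bdProb (p q : ℕ → ℝ) (n : ℕ) : ℝ := bdWeight p q n / ∑' m, bdWeight p q m

section Equilibrium

variable {p q : ℕ → ℝ}

lemma bdWeight_succ (n : ℕ) : bdWeight p q (n + 1) = bdWeight p q n * (p n / q (n + 1)) := by
  simp only [bdWeight]
  rw [Finset.prod_Icc_succ_top (by omega)]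
  simp

lemma bdWeight_pos (hp : ∀ n, 0 < p n) (hq : ∀ n, 1 ≤ n → 0 < q n) (n : ℕ) :
    0 < bdWeight p q n :=
  Finset.prod_pos fun i hi => div_pos (hp _) (hq i (Finset.mem_Icc.1 hi).1)

lemma tsum_bdWeight_pos (hp : ∀ n, 0 < p n) (hq : ∀ n, 1 ≤ n → 0 < q n)
    (herg : Summable fun n => bdWeight p q n) : 0 < ∑' m, bdWeight p q m :=
  herg.tsum_pos (fun n => (bdWeight_pos hp hq n).le) 0 (bdWeight_pos hp hq 0)

lemma bdProb_pos (hp : ∀ n, 0 < p n) (hq : ∀ n, 1 ≤ n → 0 < q n)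
    (herg : Summable fun n => bdWeight p q n) (n : ℕ) : 0 < bdProb p q n :=
  div_pos (bdWeight_pos hp hq n) (tsum_bdWeight_pos hp hq herg)

lemma bdProb_hasSum (hp : ∀ n, 0 < p n) (hq : ∀ n, 1 ≤ n → 0 < q n)
    (herg : Summable fun n => bdWeight p q n) : HasSum (bdProb p q) 1 := by
  have := herg.hasSum.div_const (∑' m, bdWeight p q m)
  rwa [div_self (tsum_bdWeight_pos hp hq herg).ne'] at this

lemma bdProb_reversible (hq : ∀ n, 1 ≤ n → 0 < q n) (n : ℕ) :
    bdProb p q n * p n = bdProb p q (n + 1) * q (n + 1) := by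
  have := (hq (n + 1) (by omega)).ne'
  simp only [bdProb, bdWeight_succ]
  field_simp

lemma tendsto_bdProb_mul (hp : ∀ n, 0 < p n) (hp1 : ∀ n, p n ≤ 1) (hq : ∀ n, 1 ≤ n → 0 < q n)
    (herg : Summable fun n => bdWeight p q n) :
    Tendsto (fun n => bdProb p q n * p n) atTop (𝓝 0) :=
  squeeze_zero (fun n => mul_nonneg (bdProb_pos hp hq herg n).le (hp n).le)
    (fun n => mul_le_of_le_one_right (bdProb_pos hp hq herg n).le (hp1 n))
    (bdProb_hasSum hp hq herg).summable.tendsto_atTop_zero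

lemma sum_smul_dirac_apply (c : ℕ → ℝ≥0∞) (A : Set ℕ) :
    (Measure.sum fun n => c n • Measure.dirac n) A = ∑' n, c n * A.indicator 1 n := by
  rw [Measure.sum_apply _ (MeasurableSet.of_discrete)]
  simp

lemma bdEquilibrium_apply (A : Set ℕ) :
    bdEquilibrium p q A = ∑' n, ENNReal.ofReal (bdProb p q n) * A.indicator 1 n :=
  sum_smul_dirac_apply _ A

lemma bdEquilibrium_singleton (n : ℕ) :
    bdEquilibrium p q {n} = ENNReal.ofReal (bdProb p q n) := by
  rw [bdEquilibrium_apply, tsum_eq_single n fun m hm => by simp [hm]]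
  simp

lemma isProbabilityMeasure_bdEquilibrium (hp : ∀ n, 0 < p n) (hq : ∀ n, 1 ≤ n → 0 < q n)
    (herg : Summable fun n => bdWeight p q n) : IsProbabilityMeasure (bdEquilibrium p q) := by
  constructor
  rw [bdEquilibrium_apply]
  have h := bdProb_hasSum hp hq herg
  simp only [indicator_univ, Pi.one_apply, mul_one]
  rw [← ENNReal.ofReal_tsum_of_nonneg (fun n => (bdProb_pos hp hq herg n).le) h.summable,
    h.tsum_eq, ENNReal.ofReal_one]

lemma evolve_apply (μ : Measure ℕ) (Q : ℕ → ℕ → ℝ) (t : ℝ≥0) (A : Set ℕ) :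
    evolve μ Q t A = ∑' i, μ {i} * ∑' j, qSemigroup Q t i j * A.indicator 1 j := by
  rw [evolve, sum_smul_dirac_apply]
  simp_rw [← ENNReal.tsum_mul_right, ← ENNReal.tsum_mul_left]
  rw [ENNReal.tsum_comm]
  simp_rw [mul_assoc]

variable {φ : ℕ → ℝ}

/-- The factor `φ` of the measure cancels the `1 / φ` of the rates, so reversibility and the
vanishing flux are those of `ν` under `Q`. -/
lemma timeChanged_pairing (hp : ∀ n, 0 < p n) (hp1 : ∀ n, p n ≤ 1) (hq : ∀ n, 1 ≤ n → 0 < q n)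
    (herg : Summable fun n => bdWeight p q n) (hφ : ∀ n, φ n ∈ Set.Ioc (0 : ℝ) 1)
    {g u : ℕ → ℝ} {C : ℝ} (hg : Monotone g) (hg0 : ∀ n, 0 ≤ g n) (hgC : ∀ n, g n ≤ C)
    (hu0 : ∀ i, 0 ≤ u i) (hu1 : ∀ i, u i ≤ 1) (hu : Antitone u) (t : ℝ≥0) :
    ENNReal.ofReal (∑' i, g i * (φ i * bdProb p q i) * u i) ≤
      ∑' i, ENNReal.ofReal (g i * (φ i * bdProb p q i)) *
        ∑' j, qSemigroup (timeChanged φ (bdGenerator p q)) t i j * ENNReal.ofReal (u j) := by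
  have hν := bdProb_pos hp hq herg
  rw [timeChanged_bdGenerator]
  simp_rw [tsum_qSemigroup_bd]
  have hcancel : ∀ n, φ n * bdProb p q n * (p n / φ n) = bdProb p q n * p n := fun n => by
    have := (hφ n).1.ne'
    field_simp
  refine ofReal_tsum_le_tsum_mul_iSup_bdIter
    (fun n => div_nonneg (hp n).le (hφ n).1.le) (fun n hn => div_nonneg (hq n hn).le (hφ n).1.le)
    (fun n => mul_nonneg (hφ n).1.le (hν n).le)
    (Summable.of_nonneg_of_le (fun n => mul_nonneg (hφ n).1.le (hν n).le)
      (fun n => mul_le_of_le_one_left (hν n).le (hφ n).2) (bdProb_hasSum hp hq herg).summable)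
    (fun n => ?_) ?_ hg hg0 hgC hu0 hu1 hu t.2
  · rw [hcancel, bdProb_reversible hq]
    have := (hφ (n + 1)).1.ne'
    field_simp
  · simp_rw [hcancel]
    exact tendsto_bdProb_mul hp hp1 hq herg

/-- The time-changed process does not explode. -/
theorem tsum_qSemigroup_timeChanged (hp : ∀ n, 0 < p n) (hp1 : ∀ n, p n ≤ 1)
    (hq : ∀ n, 1 ≤ n → 0 < q n)
    (herg : Summable fun n => bdWeight p q n) (hφ : ∀ n, φ n ∈ Set.Ioc (0 : ℝ) 1) (t : ℝ≥0)
    (i : ℕ) : ∑' j, qSemigroup (timeChanged φ (bdGenerator p q)) t i j = 1 := by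
  have hν := bdProb_pos hp hq herg
  have hle : ∀ i, ∑' j, qSemigroup (timeChanged φ (bdGenerator p q)) t i j ≤ 1 := fun i => by
    have := tsum_qSemigroup_bd (b := fun n => p n / φ n) (d := fun n => q n / φ n)
      (u := fun _ => 1) t i
    simp only [mul_one] at this
    rw [timeChanged_bdGenerator, this]
    exact iSup_le fun k => bdIter_le_one (fun n => div_nonneg (hp n).le (hφ n).1.le)
      (fun n hn => div_nonneg (hq n hn).le (hφ n).1.le) (fun _ => le_rfl) k t.2 i
  by_contra hne
  -- The total mass of `φν` does not decrease. As `φν` is finite and charges every state, losing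
  -- mass from a single state would contradict this.
  have hpair := timeChanged_pairing hp hp1 hq herg hφ (g := fun _ => 1) (u := fun _ => 1) (C := 1)
    monotone_const (fun _ => zero_le_one) (fun _ => le_rfl) (fun _ => zero_le_one)
    (fun _ => le_rfl) antitone_const t
  simp only [one_mul, mul_one, ENNReal.ofReal_one] at hpair
  have hs : Summable fun i => φ i * bdProb p q i :=
    Summable.of_nonneg_of_le (fun n => mul_nonneg (hφ n).1.le (hν n).le)
      (fun n => mul_le_of_le_one_left (hν n).le (hφ n).2) (bdProb_hasSum hp hq herg).summable
  rw [ENNReal.ofReal_tsum_of_nonneg (fun n => mul_nonneg (hφ n).1.le (hν n).le) hs] at hpair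
  refine absurd hpair (not_le.2 (ENNReal.tsum_lt_tsum (i := i) ?_ (fun j => ?_) ?_))
  · refine ne_top_of_le_ne_top (b := ∑' i, ENNReal.ofReal (φ i * bdProb p q i)) ?_
      (ENNReal.tsum_le_tsum fun j => mul_le_of_le_one_right' (hle j))
    rw [← ENNReal.ofReal_tsum_of_nonneg (fun n => mul_nonneg (hφ n).1.le (hν n).le) hs]
    exact ENNReal.ofReal_ne_top
  · exact mul_le_of_le_one_right' (hle j)
  · have h0 : 0 < ENNReal.ofReal (φ i * bdProb p q i) :=
      ENNReal.ofReal_pos.2 (mul_pos (hφ i).1 (hν i))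
    calc _ < ENNReal.ofReal (φ i * bdProb p q i) * 1 :=
          ENNReal.mul_lt_mul_right h0.ne' ENNReal.ofReal_ne_top (lt_of_le_of_ne (hle i) hne)
      _ = _ := mul_one _

theorem isProbabilityMeasure_evolve_timeChanged (hp : ∀ n, 0 < p n) (hp1 : ∀ n, p n ≤ 1)
    (hq : ∀ n, 1 ≤ n → 0 < q n)
    (herg : Summable fun n => bdWeight p q n) (hφ : ∀ n, φ n ∈ Set.Ioc (0 : ℝ) 1) (t : ℝ≥0) :
    IsProbabilityMeasure
      (evolve (bdEquilibrium p q) (timeChanged φ (bdGenerator p q)) t) := by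
  constructor
  rw [evolve_apply]
  simp only [indicator_univ, Pi.one_apply, mul_one,
    tsum_qSemigroup_timeChanged hp hp1 hq herg hφ, bdEquilibrium_singleton]
  have h := bdProb_hasSum hp hq herg
  rw [← ENNReal.ofReal_tsum_of_nonneg (fun n => (bdProb_pos hp hq herg n).le) h.summable,
    h.tsum_eq, ENNReal.ofReal_one]

theorem stochDominated_evolve_timeChanged (hp : ∀ n, 0 < p n) (hp1 : ∀ n, p n ≤ 1)
    (hq : ∀ n, 1 ≤ n → 0 < q n) (herg : Summable fun n => bdWeight p q n)
    (hφ : ∀ n, φ n ∈ Set.Ioc (0 : ℝ) 1) (hφ_anti : Antitone φ) (t : ℝ≥0) :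
    StochDominated (evolve (bdEquilibrium p q) (timeChanged φ (bdGenerator p q)) t)
      (bdEquilibrium p q) := by
  intro k
  have := isProbabilityMeasure_evolve_timeChanged hp hp1 hq herg hφ t
  have := isProbabilityMeasure_bdEquilibrium hp hq herg
  have hν := bdProb_pos hp hq herg
  rw [prob_compl_eq_one_sub MeasurableSet.of_discrete,
    prob_compl_eq_one_sub MeasurableSet.of_discrete]
  refine tsub_le_tsub_left ?_ 1
  set u : ℕ → ℝ := (Iic k).indicator 1 with hu
  have hu0 : ∀ i, 0 ≤ u i := fun i => indicator_nonneg (fun _ _ => zero_le_one) i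
  have hu1 : ∀ i, u i ≤ 1 := fun i => indicator_le_self' (fun _ _ => zero_le_one) i
  have huE : ∀ i, ENNReal.ofReal (u i) = (Iic k).indicator 1 i := fun i => by
    by_cases hi : i ≤ k <;> simp [hu, hi]
  have hanti : Antitone u := fun i j hij => by
    by_cases hj : j ≤ k
    · simp [hu, hj, hij.trans hj]
    · simpa [hu, hj] using hu0 i
  -- The density `1 / φ` of `ν` with respect to `φν`, frozen beyond `k`: bounded, and exact wherever
  -- `u ≠ 0`.
  set g : ℕ → ℝ := fun i => (φ (min i k))⁻¹ with hg
  have hpair := timeChanged_pairing hp hp1 hq herg hφ (g := g) (u := u) (C := (φ k)⁻¹)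
    (fun i j hij => inv_anti₀ (hφ _).1 (hφ_anti (min_le_min_right k hij)))
    (fun n => inv_nonneg.2 (hφ _).1.le) (fun n => inv_anti₀ (hφ _).1 (hφ_anti (min_le_right n k)))
    hu0 hu1 hanti t
  have hgle : ∀ i, g i * (φ i * bdProb p q i) ≤ bdProb p q i := fun i => by
    rw [← mul_assoc]
    refine mul_le_of_le_one_left (hν i).le ?_
    rw [hg, inv_mul_le_one₀ (hφ _).1]
    exact hφ_anti (min_le_left i k)
  have hgeq : ∀ i, g i * (φ i * bdProb p q i) * u i = bdProb p q i * u i := fun i => by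
    by_cases hi : i ≤ k
    · have := (hφ i).1.ne'
      simp only [hg, min_eq_left hi]
      field_simp
    · simp [hu, hi]
  rw [bdEquilibrium_apply, evolve_apply]
  simp only [← huE, bdEquilibrium_singleton]
  calc ∑' n, ENNReal.ofReal (bdProb p q n) * ENNReal.ofReal (u n)
      = ENNReal.ofReal (∑' i, g i * (φ i * bdProb p q i) * u i) := by
        simp_rw [hgeq, ← ENNReal.ofReal_mul (hν _).le]
        refine (ENNReal.ofReal_tsum_of_nonneg (fun i => mul_nonneg (hν i).le (hu0 i)) ?_).symm
        exact Summable.of_nonneg_of_le (fun i => mul_nonneg (hν i).le (hu0 i))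
          (fun i => mul_le_of_le_one_right (hν i).le (hu1 i)) (bdProb_hasSum hp hq herg).summable
    _ ≤ _ := hpair
    _ ≤ _ := ENNReal.tsum_le_tsum fun i =>
        mul_le_mul_left (ENNReal.ofReal_le_ofReal (hgle i)) _

end Equilibrium

/-! ### Discrete time chains observed until a random thinning -/

section Thinning

variable {Ω : Type*} [MeasurableSpace Ω] {P : Measure Ω}

/-- Additivity is applied to `P.restrict S`, so `S` may be any set. -/
lemma measure_eq_tsum_inter_fiber {α : Type*} [Countable α] {f : Ω → α}
    (hf : ∀ a, MeasurableSet (f ⁻¹' {a})) (S : Set Ω) :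
    P S = ∑' a, P (S ∩ f ⁻¹' {a}) := by
  have hd : Pairwise (Function.onFun Disjoint fun a => f ⁻¹' {a}) := fun a b hab =>
    Disjoint.preimage f (by simpa using hab)
  have hU : (⋃ a, f ⁻¹' {a}) = univ := by ext; simp
  have h := measure_iUnion (μ := P.restrict S) hd hf
  rw [hU, Measure.restrict_apply_univ] at h
  rw [h]
  exact tsum_congr fun a => by rw [Measure.restrict_apply (hf a), inter_comm]

/-- The event that the chain `y` survives the first `l` steps: `ω ∈ e r n` means that a chain which
is in state `n` at time `r + 1` survives the step from `r` to `r + 1`. -/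
def survival (y : ℕ → Ω → ℕ) (e : ℕ → ℕ → Set Ω) (l : ℕ) : Set Ω :=
  {ω | ∀ r < l, ω ∈ e r (y (r + 1) ω)}

/-- The event that the chain `y` is killed within `m` steps, in a state of `B`. -/
def killedIn (y : ℕ → Ω → ℕ) (e : ℕ → ℕ → Set Ω) (B : Set ℕ) (m : ℕ) : Set Ω :=
  {ω | ∃ l < m, ω ∈ survival y e l ∧ ω ∉ e l (y (l + 1) ω) ∧ y (l + 1) ω ∈ B}

variable {y : ℕ → Ω → ℕ} {e : ℕ → ℕ → Set Ω} {ν D v : ℕ → ℝ≥0∞} {K : ℕ → ℕ → ℝ≥0∞}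

lemma survival_succ {Ω : Type*} {y : ℕ → Ω → ℕ} {e : ℕ → ℕ → Set Ω} (l : ℕ) :
    survival y e (l + 1) = survival y e l ∩ {ω | ω ∈ e l (y (l + 1) ω)} := by
  ext ω
  simp only [survival, mem_ofPred_eq, mem_inter_iff, Nat.lt_succ_iff_lt_or_eq]
  constructor
  · exact fun h => ⟨fun r hr => h r (Or.inl hr), h l (Or.inr rfl)⟩
  · rintro ⟨h1, h2⟩ r (hr | rfl)
    exacts [h1 r hr, h2]

lemma measurableSet_step (hy : ∀ k, Measurable (y k)) (he : ∀ r n, MeasurableSet (e r n)) (l : ℕ) :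
    MeasurableSet {ω | ω ∈ e l (y (l + 1) ω)} := by
  have : {ω | ω ∈ e l (y (l + 1) ω)} = ⋃ n, (y (l + 1)) ⁻¹' {n} ∩ e l n := by
    ext ω; simp
  rw [this]
  exact MeasurableSet.iUnion fun n => (hy _ (measurableSet_singleton n)).inter (he l n)

lemma measurableSet_survival (hy : ∀ k, Measurable (y k)) (he : ∀ r n, MeasurableSet (e r n))
    (l : ℕ) : MeasurableSet (survival y e l) := by
  induction l with
  | zero => simp [survival]
  | succ l ih => rw [survival_succ]; exact ih.inter (measurableSet_step hy he l)

/-- `y` is a Markov chain with initial weights `ν` and transition matrix `K`, and given the chain, a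
step ending in state `n` is survived with probability `D n`, independently of the other steps. -/
def IsThinnedChain (P : Measure Ω) (y : ℕ → Ω → ℕ) (e : ℕ → ℕ → Set Ω) (ν D : ℕ → ℝ≥0∞)
    (K : ℕ → ℕ → ℝ≥0∞) : Prop :=
  ∀ (i : ℕ → ℕ) (m l : ℕ), l ≤ m →
    P ({ω | ∀ k ≤ m, y k ω = i k} ∩ {ω | ∀ r < l, ω ∈ e r (i (r + 1))}) =
      ν (i 0) * (∏ r ∈ Finset.range m, K (i r) (i (r + 1))) *
        ∏ r ∈ Finset.range l, D (i (r + 1))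

/-- Markov property on the survival event: the product formula for single paths is summed over all
histories up to time `l`. -/
lemma survival_transition (hy : ∀ k, Measurable (y k)) (hjoint : IsThinnedChain P y e ν D K)
    (l a b : ℕ) :
    P (survival y e l ∩ (y l ⁻¹' {a} ∩ y (l + 1) ⁻¹' {b})) =
        P (survival y e l ∩ y l ⁻¹' {a}) * K a b ∧
      P (survival y e (l + 1) ∩ (y l ⁻¹' {a} ∩ y (l + 1) ⁻¹' {b})) =
        P (survival y e l ∩ y l ⁻¹' {a}) * K a b * D b := by
  set f : Ω → Fin (l + 1) → ℕ := fun ω k => y k ω with hf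
  have hfm : ∀ π, MeasurableSet (f ⁻¹' {π}) := fun π =>
    (measurable_pi_lambda f fun k => hy k) (measurableSet_singleton π)
  have key : ∀ π : Fin (l + 1) → ℕ,
      P (survival y e l ∩ (y l ⁻¹' {a} ∩ y (l + 1) ⁻¹' {b}) ∩ f ⁻¹' {π}) =
        P (survival y e l ∩ y l ⁻¹' {a} ∩ f ⁻¹' {π}) * K a b ∧
      P (survival y e (l + 1) ∩ (y l ⁻¹' {a} ∩ y (l + 1) ⁻¹' {b}) ∩ f ⁻¹' {π}) =
        P (survival y e l ∩ y l ⁻¹' {a} ∩ f ⁻¹' {π}) * K a b * D b := by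
    intro π
    by_cases hπ : π (Fin.last l) = a
    swap
    · have hnot : ∀ ω, y l ω = a → f ω ≠ π := fun ω h1 h2 => hπ (by
        rw [← h2, ← h1]; simp [hf])
      have hempty : ∀ S T : Set Ω, S ∩ (y l ⁻¹' {a} ∩ T) ∩ f ⁻¹' {π} = ∅ := fun S T => by
        ext ω
        simp only [mem_inter_iff, mem_preimage, mem_singleton_iff, mem_empty_iff_false, iff_false]
        rintro ⟨⟨_, h1, _⟩, h2⟩
        exact hnot ω h1 h2
      have hempty' : ∀ S : Set Ω, S ∩ y l ⁻¹' {a} ∩ f ⁻¹' {π} = ∅ := fun S => by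
        ext ω
        simp only [mem_inter_iff, mem_preimage, mem_singleton_iff, mem_empty_iff_false, iff_false]
        rintro ⟨⟨_, h1⟩, h2⟩
        exact hnot ω h1 h2
      simp [hempty, hempty']
    set i : ℕ → ℕ := fun k => if h : k < l + 1 then π ⟨k, h⟩ else b with hi
    have hil : i l = a := by simp only [hi, dif_pos (Nat.lt_succ_self l)]; exact hπ
    have hib : i (l + 1) = b := by simp [hi]
    have hfi : ∀ ω, f ω = π ↔ ∀ k ≤ l, y k ω = i k := fun ω => by
      rw [funext_iff]
      constructor
      · intro h k hk
        rw [hi]; simp only [dif_pos (Nat.lt_succ_of_le hk)]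
        exact h ⟨k, Nat.lt_succ_of_le hk⟩
      · intro h k
        have := h k (Nat.lt_succ_iff.1 k.2)
        rw [hi] at this; simp only [dif_pos k.2] at this
        exact this
    have hall : ∀ ω, (∀ k ≤ l + 1, y k ω = i k) ↔ (∀ k ≤ l, y k ω = i k) ∧ y (l + 1) ω = b :=
      fun ω => by
        constructor
        · exact fun h => ⟨fun k hk => h k (hk.trans (Nat.le_succ l)), by
            rw [← hib]; exact h _ le_rfl⟩
        · rintro ⟨h1, h2⟩ k hk
          rcases Nat.lt_or_ge k (l + 1) with hk' | hk'
          · exact h1 k (by omega)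
          · obtain rfl : k = l + 1 := by omega
            rw [h2, hib]
    have hs : ∀ ω, ∀ m, m ≤ l + 1 → (∀ k ≤ m, y k ω = i k) →
        (ω ∈ survival y e m ↔ ∀ r < m, ω ∈ e r (i (r + 1))) := fun ω m _ h =>
      forall₂_congr fun r hr => by rw [h (r + 1) hr]
    have e1 : survival y e l ∩ (y l ⁻¹' {a} ∩ y (l + 1) ⁻¹' {b}) ∩ f ⁻¹' {π} =
        {ω | ∀ k ≤ l + 1, y k ω = i k} ∩ {ω | ∀ r < l, ω ∈ e r (i (r + 1))} := by
      ext ω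
      simp only [mem_inter_iff, mem_preimage, mem_singleton_iff, mem_ofPred_eq, hfi, hall]
      constructor
      · rintro ⟨⟨h1, _, h3⟩, h4⟩
        exact ⟨⟨h4, h3⟩, (hs ω l (Nat.le_succ l) h4).1 h1⟩
      · rintro ⟨⟨h4, h3⟩, h1⟩
        exact ⟨⟨(hs ω l (Nat.le_succ l) h4).2 h1, (h4 l le_rfl).trans hil, h3⟩, h4⟩
    have e2 : survival y e (l + 1) ∩ (y l ⁻¹' {a} ∩ y (l + 1) ⁻¹' {b}) ∩ f ⁻¹' {π} =
        {ω | ∀ k ≤ l + 1, y k ω = i k} ∩ {ω | ∀ r < l + 1, ω ∈ e r (i (r + 1))} := by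
      ext ω
      simp only [mem_inter_iff, mem_preimage, mem_singleton_iff, mem_ofPred_eq, hfi]
      constructor
      · rintro ⟨⟨h1, _, h3⟩, h4⟩
        have h5 := (hall ω).2 ⟨h4, h3⟩
        exact ⟨h5, (hs ω _ le_rfl h5).1 h1⟩
      · rintro ⟨h5, h1⟩
        obtain ⟨h4, h3⟩ := (hall ω).1 h5
        exact ⟨⟨(hs ω _ le_rfl h5).2 h1, (h4 l le_rfl).trans hil, h3⟩, h4⟩
    have e3 : survival y e l ∩ y l ⁻¹' {a} ∩ f ⁻¹' {π} =
        {ω | ∀ k ≤ l, y k ω = i k} ∩ {ω | ∀ r < l, ω ∈ e r (i (r + 1))} := by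
      ext ω
      simp only [mem_inter_iff, mem_preimage, mem_singleton_iff, mem_ofPred_eq, hfi]
      constructor
      · rintro ⟨⟨h1, _⟩, h4⟩
        exact ⟨h4, (hs ω l (Nat.le_succ l) h4).1 h1⟩
      · rintro ⟨h4, h1⟩
        exact ⟨⟨(hs ω l (Nat.le_succ l) h4).2 h1, (h4 l le_rfl).trans hil⟩, h4⟩
    rw [e1, e2, e3, hjoint i _ _ (Nat.le_succ l), hjoint i _ _ le_rfl, hjoint i _ _ le_rfl,
      Finset.prod_range_succ, Finset.prod_range_succ (n := l), hil, hib]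
    constructor <;> ring
  rw [measure_eq_tsum_inter_fiber hfm (survival y e l ∩ (y l ⁻¹' {a} ∩ y (l + 1) ⁻¹' {b})),
    measure_eq_tsum_inter_fiber hfm (survival y e (l + 1) ∩ (y l ⁻¹' {a} ∩ y (l + 1) ⁻¹' {b})),
    measure_eq_tsum_inter_fiber hfm (survival y e l ∩ y l ⁻¹' {a}),
    ← ENNReal.tsum_mul_right, ← ENNReal.tsum_mul_right]
  exact ⟨tsum_congr fun π => (key π).1, tsum_congr fun π => (key π).2⟩

lemma survival_succ_state (hy : ∀ k, Measurable (y k)) (hjoint : IsThinnedChain P y e ν D K)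
    (l b : ℕ) :
    P (survival y e (l + 1) ∩ y (l + 1) ⁻¹' {b}) =
      P (survival y e l ∩ y (l + 1) ⁻¹' {b}) * D b := by
  have h := fun a => survival_transition hy hjoint l a b
  rw [measure_eq_tsum_inter_fiber (fun a => hy l (measurableSet_singleton a))
      (survival y e (l + 1) ∩ y (l + 1) ⁻¹' {b}),
    measure_eq_tsum_inter_fiber (fun a => hy l (measurableSet_singleton a))
      (survival y e l ∩ y (l + 1) ⁻¹' {b}), ← ENNReal.tsum_mul_right]
  refine tsum_congr fun a => ?_
  rw [inter_assoc, inter_assoc, inter_comm (y (l + 1) ⁻¹' {b}), (h a).1, (h a).2]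

/-- A bounded function which is almost superharmonic for the chain with reward `1` on being killed
in `B` almost dominates the probability of being killed in `B`. -/
theorem measure_killedIn_le [IsProbabilityMeasure P] (hy : ∀ k, Measurable (y k))
    (hjoint : IsThinnedChain P y e ν D K) (he : ∀ r n, MeasurableSet (e r n))
    {B : Set ℕ} {ε : ℝ≥0∞}
    (hsuper : ∀ a, ∑' b, K a b * (D b * v b + (1 - D b) * B.indicator 1 b) ≤ v a + ε) (m : ℕ) :
    P (killedIn y e B m) ≤ ∑' a, ν a * v a + m * ε := by
  -- The induction follows the supermartingale: reward already collected plus `v` at the current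
  -- state of the survivors. Each step adds at most `ε`.
  suffices h : P (killedIn y e B m) + ∑' a, P (survival y e m ∩ y m ⁻¹' {a}) * v a ≤
      ∑' a, ν a * v a + m * ε from le_self_add.trans h
  induction m with
  | zero =>
    have h0 : ∀ a, P (survival y e 0 ∩ y 0 ⁻¹' {a}) = ν a := fun a => by
      have := hjoint (fun _ => a) 0 0 le_rfl
      simp only [Finset.range_zero, Finset.prod_empty, mul_one] at this
      rw [← this]
      congr 1
      ext ω; simp [survival]
    simp [h0, killedIn]
  | succ m ih =>
    set x : ℕ → ℝ≥0∞ := fun a => P (survival y e m ∩ y m ⁻¹' {a}) with hx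
    have hxsum : ∑' a, x a ≤ 1 := by
      rw [← measure_eq_tsum_inter_fiber (fun a => hy m (measurableSet_singleton a))]
      exact prob_le_one
    have htr := survival_transition hy hjoint m
    have hkill : P (killedIn y e B (m + 1)) ≤ P (killedIn y e B m) +
        ∑' b, ∑' a, x a * K a b * ((1 - D b) * B.indicator 1 b) := by
      have hsub : killedIn y e B (m + 1) ⊆ killedIn y e B m ∪
          {ω | ω ∈ survival y e m ∧ ω ∉ e m (y (m + 1) ω) ∧ y (m + 1) ω ∈ B} := by
        rintro ω ⟨l, hl, h⟩
        rcases Nat.lt_succ_iff_lt_or_eq.1 hl with hl | rfl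
        exacts [Or.inl ⟨l, hl, h⟩, Or.inr h]
      refine (measure_mono hsub).trans ((measure_union_le _ _).trans (add_le_add le_rfl ?_))
      rw [measure_eq_tsum_inter_fiber (fun a => hy (m + 1) (measurableSet_singleton a))]
      refine ENNReal.tsum_le_tsum fun b => ?_
      rw [measure_eq_tsum_inter_fiber (fun a => hy m (measurableSet_singleton a))]
      refine ENNReal.tsum_le_tsum fun a => ?_
      by_cases hb : b ∈ B
      swap
      · refine le_of_eq_of_le (measure_mono_null (t := ∅) ?_ measure_empty) zero_le
        rintro ω ⟨⟨⟨_, _, h1⟩, h2⟩, _⟩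
        rw [mem_preimage, mem_singleton_iff] at h2
        exact hb (h2 ▸ h1)
      have hsub2 : {ω | ω ∈ survival y e m ∧ ω ∉ e m (y (m + 1) ω) ∧ y (m + 1) ω ∈ B} ∩
          y (m + 1) ⁻¹' {b} ∩ y m ⁻¹' {a} ⊆
          (survival y e m ∩ (y m ⁻¹' {a} ∩ y (m + 1) ⁻¹' {b})) \
            (survival y e (m + 1) ∩ (y m ⁻¹' {a} ∩ y (m + 1) ⁻¹' {b})) := by
        rintro ω ⟨⟨⟨h1, h2, _⟩, h3⟩, h4⟩
        refine ⟨⟨h1, h4, h3⟩, fun h => h2 ?_⟩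
        have := h.1
        rw [survival_succ] at this
        exact this.2
      refine (measure_mono hsub2).trans ?_
      rw [measure_sdiff]
      · rw [(htr a b).1, (htr a b).2, indicator_of_mem hb, Pi.one_apply, mul_one,
          ENNReal.mul_sub]
        · rw [mul_one]
        · intro _ _
          rw [← (htr a b).1]
          exact measure_ne_top _ _
      · rw [survival_succ]
        exact inter_subset_inter_left _ inter_subset_left
      · exact ((measurableSet_survival hy he _).inter ((hy _ (measurableSet_singleton _)).inter
          (hy _ (measurableSet_singleton _)))).nullMeasurableSet
      · exact measure_ne_top _ _
    have hsurv : ∑' b, P (survival y e (m + 1) ∩ y (m + 1) ⁻¹' {b}) * v b =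
        ∑' b, ∑' a, x a * K a b * (D b * v b) := by
      refine tsum_congr fun b => ?_
      rw [measure_eq_tsum_inter_fiber (fun a => hy m (measurableSet_singleton a)),
        ← ENNReal.tsum_mul_right]
      refine tsum_congr fun a => ?_
      rw [inter_assoc, inter_comm (y (m + 1) ⁻¹' {b}), (htr a b).2]
      ring
    rw [hsurv]
    calc _ ≤ P (killedIn y e B m) +
          ∑' b, ∑' a, x a * K a b * ((1 - D b) * B.indicator 1 b) +
          ∑' b, ∑' a, x a * K a b * (D b * v b) := add_le_add hkill le_rfl
      _ = P (killedIn y e B m) +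
          ∑' a, x a * ∑' b, K a b * (D b * v b + (1 - D b) * B.indicator 1 b) := by
          rw [add_assoc, ← ENNReal.tsum_add]
          simp_rw [← ENNReal.tsum_add, ← ENNReal.tsum_mul_left]
          rw [ENNReal.tsum_comm]
          congr 1
          refine tsum_congr fun a => tsum_congr fun b => ?_
          ring
      _ ≤ P (killedIn y e B m) + ∑' a, x a * (v a + ε) := by
          gcongr with a
          exact hsuper a
      _ ≤ P (killedIn y e B m) + (∑' a, x a * v a + ε) := by
          simp_rw [mul_add]
          rw [ENNReal.tsum_add, ENNReal.tsum_mul_right]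
          gcongr
          exact mul_le_of_le_one_left' hxsum
      _ ≤ ∑' a, ν a * v a + m * ε + ε := by
          rw [← add_assoc]
          exact add_le_add ih le_rfl
      _ = _ := by push_cast; ring

/-- If the chain is unlikely to be above `N`, where the killing is slow, then it is killed fast. -/
theorem measure_survival_le [IsProbabilityMeasure P] (hy : ∀ k, Measurable (y k))
    (hjoint : IsThinnedChain P y e ν D K) {N : ℕ} {δ D' : ℝ≥0∞} (hδ : ∀ k, P (y k ⁻¹' (Iic N)ᶜ) ≤ δ)
    (hDN : ∀ n ≤ N, D n ≤ D') (hD' : D' ≤ 1) (m : ℕ) :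
    P (survival y e m) ≤ δ + D' ^ m := by
  induction m with
  | zero => exact prob_le_one.trans (by simp)
  | succ m ih =>
    have hS : MeasurableSet (y (m + 1) ⁻¹' (Iic N)) := hy _ MeasurableSet.of_discrete
    set z := P (survival y e m ∩ (y (m + 1) ⁻¹' (Iic N))ᶜ) with hz
    set w := P (survival y e m ∩ y (m + 1) ⁻¹' (Iic N)) with hw
    have hwz : w + z = P (survival y e m) := measure_inter_add_sdiff _ hS
    have h1 : P (survival y e (m + 1) ∩ y (m + 1) ⁻¹' (Iic N)) ≤ D' * w := by
      rw [hw, measure_eq_tsum_inter_fiber (fun a => hy (m + 1) (measurableSet_singleton a)),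
        measure_eq_tsum_inter_fiber (S := survival y e m ∩ _)
          (fun a => hy (m + 1) (measurableSet_singleton a)), ← ENNReal.tsum_mul_left]
      refine ENNReal.tsum_le_tsum fun b => ?_
      by_cases hb : b ≤ N
      · have hset : y (m + 1) ⁻¹' (Iic N) ∩ y (m + 1) ⁻¹' {b} = y (m + 1) ⁻¹' {b} := by
          rw [← preimage_inter, inter_eq_right.2 (by simpa using hb)]
        rw [inter_assoc, inter_assoc, hset, survival_succ_state hy hjoint, mul_comm]
        gcongr
        exact hDN b hb
      · have hset : y (m + 1) ⁻¹' (Iic N) ∩ y (m + 1) ⁻¹' {b} = ∅ := by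
          rw [← preimage_inter, disjoint_iff_inter_eq_empty.1 (by simpa using hb), preimage_empty]
        rw [inter_assoc, inter_assoc, hset]
        simp
    have h2 : P (survival y e (m + 1) ∩ (y (m + 1) ⁻¹' (Iic N))ᶜ) ≤ z := by
      rw [survival_succ]
      exact measure_mono (inter_subset_inter_left _ inter_subset_left)
    have hzδ : z ≤ δ := (measure_mono inter_subset_right).trans (hδ (m + 1))
    have hDD : D' + (1 - D') = 1 := add_tsub_cancel_of_le hD'
    calc P (survival y e (m + 1)) = P (survival y e (m + 1) ∩ y (m + 1) ⁻¹' (Iic N)) +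
          P (survival y e (m + 1) ∩ (y (m + 1) ⁻¹' (Iic N))ᶜ) :=
          (measure_inter_add_sdiff _ hS).symm
      -- Writing `z = D' z + (1 - D') z` makes the bound a convex combination, so `δ` does not
      -- accumulate over the steps.
      _ ≤ D' * w + (D' + (1 - D')) * z := by
          rw [hDD, one_mul]; exact add_le_add h1 h2
      _ = D' * P (survival y e m) + (1 - D') * z := by rw [← hwz]; ring
      _ ≤ D' * (δ + D' ^ m) + (1 - D') * δ := by gcongr
      _ = (D' + (1 - D')) * δ + D' ^ (m + 1) := by ring
      _ = δ + D' ^ (m + 1) := by rw [hDD, one_mul]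

end Thinning

/-! ### Superharmonic functions for the chain killed at rate `φ` -/

section Superharmonic

variable {p q φ : ℕ → ℝ}

lemma bdDrift_div (x : ℕ → ℝ) (i : ℕ) :
    bdDrift (fun n => p n / φ n) (fun n => q n / φ n) x i = bdDrift p q x i / φ i := by
  simp only [bdDrift, deathRate]
  split_ifs <;> ring

/-- One step of the discretized thinned chain, applied to a superharmonic function. -/
lemma tsum_qSemigroup_thinned_le (hp : ∀ n, 0 ≤ p n) (hq : ∀ n, 1 ≤ n → 0 ≤ q n)
    (hrate : ∀ i, p i + deathRate q i ≤ 1) (hφ : ∀ n, φ n ∈ Set.Ioc (0 : ℝ) 1) {v f : ℕ → ℝ}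
    (hv0 : ∀ i, 0 ≤ v i) (hv1 : ∀ i, v i ≤ 1) (hf0 : ∀ i, 0 ≤ f i) (hf1 : ∀ i, f i ≤ 1)
    (hsuper : ∀ i, bdDrift p q v i ≤ φ i * (v i - f i)) {h : ℝ≥0} (hh : h ≤ 1) (i : ℕ) :
    ∑' j, qSemigroup (bdGenerator p q) h i j *
        (ENNReal.ofReal (Real.exp (-(φ j * h))) * ENNReal.ofReal (v j) +
          (1 - ENNReal.ofReal (Real.exp (-(φ j * h)))) * ENNReal.ofReal (f j)) ≤
      ENNReal.ofReal (v i) + ENNReal.ofReal (5 * (h : ℝ) ^ 2) := by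
  have hh0 : (0 : ℝ) ≤ h := h.2
  have hh1 : (h : ℝ) ≤ 1 := hh
  -- Linearization in `h` of killing at rate `φ`. The constant `5` is `1` from this linearization,
  -- `2` from the semigroup expansion and `2` from the drift of `φ(f - v)`; the first-order terms
  -- cancel by `hsuper`.
  set x : ℕ → ℝ := fun j => v j + φ j * h * (f j - v j) with hx
  have hy0 : ∀ j, 0 ≤ φ j * h := fun j => mul_nonneg (hφ j).1.le hh0
  have hyh : ∀ j, φ j * h ≤ h := fun j => mul_le_of_le_one_left hh0 (hφ j).2
  have hy1 : ∀ j, φ j * h ≤ 1 := fun j => (hyh j).trans hh1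
  have hxe : ∀ j, x j = (1 - φ j * h) * v j + φ j * h * f j := fun j => by simp only [hx]; ring
  have hx0 : ∀ j, 0 ≤ x j := fun j => by
    rw [hxe]
    exact add_nonneg (mul_nonneg (by linarith [hy1 j]) (hv0 j)) (mul_nonneg (hy0 j) (hf0 j))
  have hx1 : ∀ j, x j ≤ 1 := fun j => by
    rw [hxe]
    have h1 := mul_le_mul_of_nonneg_left (hv1 j) (show 0 ≤ 1 - φ j * h by linarith [hy1 j])
    have h2 := mul_le_mul_of_nonneg_left (hf1 j) (hy0 j)
    linarith
  have hstep : ∀ j, ENNReal.ofReal (Real.exp (-(φ j * h))) * ENNReal.ofReal (v j) +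
      (1 - ENNReal.ofReal (Real.exp (-(φ j * h)))) * ENNReal.ofReal (f j) ≤
      ENNReal.ofReal (x j) + ENNReal.ofReal ((h : ℝ) ^ 2) := fun j => by
    set D := Real.exp (-(φ j * h)) with hD
    have hD0 : 0 < D := Real.exp_pos _
    have hD1 : D ≤ 1 := Real.exp_le_one_iff.2 (by linarith [hy0 j])
    have hDl : 1 - φ j * h ≤ D := by linarith [Real.add_one_le_exp (-(φ j * h))]
    have hDu : D ≤ 1 - φ j * h + (φ j * h) ^ 2 := by
      have h1 : D * (1 + φ j * h) ≤ 1 := by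
        calc _ ≤ D * Real.exp (φ j * h) :=
              mul_le_mul_of_nonneg_left (by linarith [Real.add_one_le_exp (φ j * h)]) hD0.le
          _ = 1 := by rw [hD, ← Real.exp_add]; simp
      nlinarith [pow_nonneg (hy0 j) 3]
    have hsq : (φ j * h) ^ 2 ≤ (h : ℝ) ^ 2 := pow_le_pow_left₀ (hy0 j) (hyh j) 2
    rw [← ENNReal.ofReal_one, ← ENNReal.ofReal_sub _ hD0.le, ← ENNReal.ofReal_mul hD0.le,
      ← ENNReal.ofReal_mul (by linarith), ← ENNReal.ofReal_add (mul_nonneg hD0.le (hv0 j))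
        (mul_nonneg (by linarith) (hf0 j)), ← ENNReal.ofReal_add (hx0 j) (sq_nonneg _)]
    refine ENNReal.ofReal_le_ofReal ?_
    have e1 : D * v j + (1 - D) * f j - x j = (D - (1 - φ j * h)) * (v j - f j) := by
      simp only [hx]; ring
    have e2 : (D - (1 - φ j * h)) * (v j - f j) ≤ (D - (1 - φ j * h)) * 1 :=
      mul_le_mul_of_nonneg_left (by linarith [hv1 j, hf0 j]) (by linarith)
    linarith
  have hPx : ∑' j, qSemigroup (bdGenerator p q) h i j * ENNReal.ofReal (x j) ≤
      ENNReal.ofReal (x i + h * bdDrift p q x i + 2 * (h : ℝ) ^ 2) := by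
    rw [tsum_qSemigroup_bd (u := fun j => ENNReal.ofReal (x j))]
    exact iSup_le fun k => bdIter_le_expansion hp hq hrate hx0 hx1 k hh0 i
  have hP1 : ∑' j, qSemigroup (bdGenerator p q) h i j ≤ 1 := by
    have := tsum_qSemigroup_bd (b := p) (d := q) (u := fun _ => 1) h i
    simp only [mul_one] at this
    rw [this]
    exact iSup_le fun k => bdIter_le_one hp hq (fun _ => le_rfl) k hh0 i
  have hdrift : x i + h * bdDrift p q x i + 2 * (h : ℝ) ^ 2 ≤ v i + 4 * (h : ℝ) ^ 2 := by
    set z : ℕ → ℝ := fun j => φ j * (f j - v j) with hz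
    have hz1 : ∀ j, |z j| ≤ 1 := fun j => by
      simp only [hz]
      rw [abs_mul, abs_of_pos (hφ j).1]
      refine mul_le_one₀ (hφ j).2 (abs_nonneg _) (abs_le.2 ⟨?_, ?_⟩) <;>
        linarith [hv0 j, hv1 j, hf0 j, hf1 j]
    have hdz : bdDrift p q x i = bdDrift p q v i + h * bdDrift p q z i := by
      simp only [bdDrift, hx, hz]; ring
    have hzb : bdDrift p q z i ≤ 2 := by
      have hd' := deathRate_nonneg hq i
      have h0 := abs_le.1 (hz1 i)
      have h1 := abs_le.1 (hz1 (i + 1))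
      have h2 := abs_le.1 (hz1 (i - 1))
      have h3 : p i * (z (i + 1) - z i) ≤ p i * 2 :=
        mul_le_mul_of_nonneg_left (by linarith) (hp i)
      have h4 : deathRate q i * (z (i - 1) - z i) ≤ deathRate q i * 2 :=
        mul_le_mul_of_nonneg_left (by linarith) hd'
      simp only [bdDrift]
      linarith [hrate i]
    have h5 := mul_le_mul_of_nonneg_left (hsuper i) hh0
    have h6 := mul_le_mul_of_nonneg_left hzb (sq_nonneg (h : ℝ))
    rw [hdz]
    simp only [hx]
    nlinarith
  calc _ ≤ ∑' j, qSemigroup (bdGenerator p q) h i j *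
        (ENNReal.ofReal (x j) + ENNReal.ofReal ((h : ℝ) ^ 2)) :=
        ENNReal.tsum_le_tsum fun j => mul_le_mul_right (hstep j) _
    _ = ∑' j, qSemigroup (bdGenerator p q) h i j * ENNReal.ofReal (x j) +
        (∑' j, qSemigroup (bdGenerator p q) h i j) * ENNReal.ofReal ((h : ℝ) ^ 2) := by
        simp_rw [mul_add]
        rw [ENNReal.tsum_add, ENNReal.tsum_mul_right]
    _ ≤ ENNReal.ofReal (v i + 4 * (h : ℝ) ^ 2) + ENNReal.ofReal ((h : ℝ) ^ 2) :=
        add_le_add (hPx.trans (ENNReal.ofReal_le_ofReal hdrift)) (mul_le_of_le_one_left' hP1)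
    _ = _ := by
        rw [← ENNReal.ofReal_add (by positivity [hv0 i]) (by positivity),
          ← ENNReal.ofReal_add (hv0 i) (by positivity)]
        congr 1; ring

/-- There are superharmonic functions for the chain killed at rate `φ`, with reward `1` on being
killed above `k`, whose mean is almost bounded by the equilibrium probability of being above `k`. -/
theorem exists_superharmonic (hp : ∀ n, 0 < p n) (hp1 : ∀ n, p n ≤ 1)
    (hq : ∀ n, 1 ≤ n → 0 < q n) (herg : Summable fun n => bdWeight p q n)
    (hφ : ∀ n, φ n ∈ Set.Ioc (0 : ℝ) 1) (hφ_anti : Antitone φ) (k : ℕ) {ε : ℝ} (hε : 0 < ε) :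
    ∃ v : ℕ → ℝ, (∀ i, 0 ≤ v i) ∧ (∀ i, v i ≤ 1) ∧
      (∀ i, bdDrift p q v i ≤ φ i * (v i - (Iic k)ᶜ.indicator 1 i)) ∧
      ∑' i, ENNReal.ofReal (bdProb p q i) * ENNReal.ofReal (v i) ≤
        bdEquilibrium p q (Iic k)ᶜ + ENNReal.ofReal ε := by
  have hν := bdProb_pos hp hq herg
  have hνs := bdProb_hasSum hp hq herg
  set u : ℕ → ℝ := (Iic k).indicator 1 with hu
  have hu0 : ∀ i, 0 ≤ u i := fun i => indicator_nonneg (fun _ _ => zero_le_one) i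
  have hu1 : ∀ i, u i ≤ 1 := fun i => indicator_le_self' (fun _ _ => zero_le_one) i
  have hanti : Antitone u := fun i j hij => by
    by_cases hj : j ≤ k
    · simp [hu, hj, hij.trans hj]
    · simpa [hu, hj] using hu0 i
  have hf : ∀ i, (Iic k)ᶜ.indicator 1 i = 1 - u i := fun i => by
    by_cases hi : i ≤ k <;> simp [hu, hi, indicator]
  have hfE : ∀ i, (Iic k)ᶜ.indicator 1 i = ENNReal.ofReal (1 - u i) := fun i => by
    by_cases hi : i ≤ k <;> simp [hu, hi, indicator]
  set g : ℕ → ℝ := fun i => (φ (min i k))⁻¹ with hg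
  have hgm : Monotone g := fun i j hij => inv_anti₀ (hφ _).1 (hφ_anti (min_le_min_right k hij))
  obtain ⟨N, hNk, hN⟩ : ∃ N, k ≤ N ∧ (φ k)⁻¹ * (bdProb p q N * p N) < ε := by
    have h1 := (tendsto_bdProb_mul hp hp1 hq herg).const_mul (φ k)⁻¹
    rw [mul_zero] at h1
    exact ((eventually_ge_atTop k).and (h1.eventually (gt_mem_nhds hε))).exists
  obtain ⟨w, hw0, hw1, hwa, hwN, hw⟩ := exists_killed_resolvent (b := fun n => p n / φ n)
    (d := fun n => q n / φ n) (fun n => div_nonneg (hp n).le (hφ n).1.le)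
    (fun n hn => div_nonneg (hq n hn).le (hφ n).1.le) hu0 hu1 hanti (N + 1)
  simp only [bdDrift_div] at hw
  have hdriftv : ∀ i, bdDrift p q (fun j => 1 - w j) i = -bdDrift p q w i := fun i => by
    simp only [bdDrift]; ring
  -- Complementing turns the resolvent of `{0,…,k}` into one for `{k+1,…}`. Below `N + 1` the
  -- inequality is an equality; from `N + 1` on, `w = u = 0` and only a nonnegative inflow remains.
  refine ⟨fun i => 1 - w i, fun i => by linarith [hw1 i], fun i => by linarith [hw0 i],
    fun i => ?_, ?_⟩
  · rw [hdriftv, hf]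
    by_cases hi : i < N + 1
    · have h1 := hw i hi
      have h2 : bdDrift p q w i = φ i * (w i - u i) := by
        have h3 : bdDrift p q w i / φ i = w i - u i := by linarith
        rw [div_eq_iff (hφ i).1.ne'] at h3
        rw [h3, mul_comm]
      rw [h2]
      exact le_of_eq (by ring)
    · have hui : u i = 0 := by
        have : ¬ i ≤ k := by omega
        simp [hu, this]
      have h0 : 0 ≤ bdDrift p q w i := by
        simp only [bdDrift, hwN i (not_lt.1 hi), sub_zero]
        exact add_nonneg (mul_nonneg (hp i).le (hw0 _))
          (mul_nonneg (deathRate_nonneg (fun n hn => (hq n hn).le) i) (hw0 _))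
      simp only [hui, hwN i (not_lt.1 hi)]
      linarith
  · have hc : ∀ n, φ n * bdProb p q n * (p n / φ n) = bdProb p q n * p n := fun n => by
      have := (hφ n).1.ne'
      field_simp
    have henergy := sum_mul_bdDrift_ge (b := fun n => p n / φ n) (d := fun n => q n / φ n)
      (π := fun n => φ n * bdProb p q n) (g := g) (x := w)
      (fun n => div_nonneg (hp n).le (hφ n).1.le) (fun n => mul_nonneg (hφ n).1.le (hν n).le)
      (fun n => by
        rw [hc, bdProb_reversible hq]
        have := (hφ (n + 1)).1.ne'
        field_simp) hgm hwa N
    simp only [bdDrift_div] at henergy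
    rw [hc, hwN (N + 1) le_rfl, sub_zero] at henergy
    have hgle : ∀ i, g i * (φ i * bdProb p q i) ≤ bdProb p q i := fun i => by
      rw [← mul_assoc]
      refine mul_le_of_le_one_left (hν i).le ?_
      rw [hg, inv_mul_le_one₀ (hφ _).1]
      exact hφ_anti (min_le_left i k)
    have hgeq : ∀ i, g i * (φ i * bdProb p q i) * u i = bdProb p q i * u i := fun i => by
      by_cases hi : i ≤ k
      · have := (hφ i).1.ne'
        simp only [hg, min_eq_left hi]
        field_simp
      · simp [hu, hi]
    have hterm : ∑ i ∈ Finset.range (N + 1), g i * (φ i * bdProb p q i) *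
        (bdDrift p q w i / φ i) ≤
        ∑ i ∈ Finset.range (N + 1), (bdProb p q i * w i - bdProb p q i * u i) := by
      refine Finset.sum_le_sum fun i hi => ?_
      rw [← hgeq i, show bdDrift p q w i / φ i = w i - u i by
        linarith [hw i (Finset.mem_range.1 hi)], mul_sub]
      exact sub_le_sub_right (mul_le_mul_of_nonneg_right (hgle i) (hw0 i)) _
    have hflux : g N * (bdProb p q N * p N) * w N ≤ ε := by
      have h0 : 0 ≤ g N * (bdProb p q N * p N) :=
        mul_nonneg (inv_nonneg.2 (hφ _).1.le) (mul_nonneg (hν N).le (hp N).le)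
      refine (mul_le_of_le_one_right h0 (hw1 N)).trans ?_
      simp only [hg, min_eq_right hNk]
      exact hN.le
    have hsw : HasSum (fun i => bdProb p q i * w i - bdProb p q i * u i)
        (∑ i ∈ Finset.range (N + 1), (bdProb p q i * w i - bdProb p q i * u i)) := by
      refine hasSum_sum_of_ne_finset_zero fun i hi => ?_
      have hi' : N + 1 ≤ i := by simpa using hi
      have : ¬ i ≤ k := by omega
      simp [hwN i hi', hu, this]
    have hsf : Summable fun i => bdProb p q i * (1 - u i) :=
      Summable.of_nonneg_of_le (fun i => mul_nonneg (hν i).le (by linarith [hu1 i]))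
        (fun i => mul_le_of_le_one_right (hν i).le (by linarith [hu0 i])) hνs.summable
    have hsv : HasSum (fun i => bdProb p q i * (1 - w i)) (∑' i, bdProb p q i * (1 - u i) -
        ∑ i ∈ Finset.range (N + 1), (bdProb p q i * w i - bdProb p q i * u i)) := by
      have heq : (fun i => bdProb p q i * (1 - w i)) = fun i => bdProb p q i * (1 - u i) -
          (bdProb p q i * w i - bdProb p q i * u i) := by funext i; ring
      rw [heq]
      exact hsf.hasSum.sub hsw
    rw [bdEquilibrium_apply]
    simp_rw [hfE, ← ENNReal.ofReal_mul (hν _).le]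
    rw [← ENNReal.ofReal_tsum_of_nonneg
        (fun i => mul_nonneg (hν i).le (by linarith [hw1 i])) hsv.summable,
      ← ENNReal.ofReal_tsum_of_nonneg
        (fun i => mul_nonneg (hν i).le (by linarith [hu1 i])) hsf,
      ← ENNReal.ofReal_add (tsum_nonneg fun i =>
        mul_nonneg (hν i).le (by linarith [hu1 i])) hε.le, hsv.tsum_eq]
    refine ENNReal.ofReal_le_ofReal ?_
    linarith

end Superharmonic

/-! ### The environment and the Poisson points in discretized time -/

/-- The part of the cube of the origin whose last coordinate is within `c` of the lower face. -/
def thinnedCube (d : ℕ) (c : ℝ) : Set (Fin (d + 1) → ℝ) :=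
  {y | y ∈ originCube d ∧ y (Fin.last d) ∈ Set.Ico (-1 / 2 : ℝ) (-1 / 2 + c)}

/-- The points over the time interval `(r h, (r + 1) h]` retained in the environment state with
retention probability `c`. -/
def thinnedSlab (d : ℕ) (c : ℝ) (h : ℝ≥0) (r : ℕ) : Set ((Fin (d + 1) → ℝ) × ℝ≥0) :=
  thinnedCube d c ×ˢ Ioc (r * h) ((r + 1) * h)

section Volume

variable {d : ℕ}

lemma thinnedCube_eq {c : ℝ} (hc1 : c ≤ 1) :
    thinnedCube d c = Set.pi univ fun i =>
      Ico (-1 / 2 : ℝ) (if i = Fin.last d then -1 / 2 + c else 1 / 2) := by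
  ext y
  simp only [thinnedCube, originCube, mem_ofPred_eq, Set.mem_pi, mem_univ, true_implies]
  constructor
  · rintro ⟨h1, h2⟩ i
    split_ifs with hi
    · rw [hi]; exact h2
    · exact h1 i
  · intro h
    have hl := h (Fin.last d)
    rw [if_pos rfl] at hl
    refine ⟨fun i => ?_, hl⟩
    by_cases hi : i = Fin.last d
    · rw [hi]; exact ⟨hl.1, by linarith [hl.2]⟩
    · have := h i
      rwa [if_neg hi] at this

lemma measurableSet_thinnedCube {c : ℝ} (hc1 : c ≤ 1) : MeasurableSet (thinnedCube d c) := by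
  rw [thinnedCube_eq hc1]
  exact MeasurableSet.univ_pi fun _ => measurableSet_Ico

lemma volume_thinnedCube {c : ℝ} (hc1 : c ≤ 1) :
    volume (thinnedCube d c) = ENNReal.ofReal c := by
  rw [thinnedCube_eq hc1, Real.volume_pi_Ico, Fin.prod_univ_castSucc]
  have h1 : ∀ i : Fin d, (if i.castSucc = Fin.last d then -1 / 2 + c else 1 / 2) - (-1 / 2) =
      (1 : ℝ) := fun i => by
    rw [if_neg (Fin.castSucc_lt_last i).ne]; norm_num
  simp only [h1, ENNReal.ofReal_one, Finset.prod_const_one, one_mul, if_true]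
  congr 1; ring

lemma thinnedCube_one : thinnedCube d 1 = originCube d := by
  ext y
  simp only [thinnedCube, mem_ofPred_eq, and_iff_left_iff_imp]
  intro hy
  have := hy (Fin.last d)
  exact ⟨this.1, by linarith [this.2]⟩

lemma nnrealLebesgue_Ioc (a b : ℝ≥0) : nnrealLebesgue (Ioc a b) = (b : ℝ≥0∞) - a := by
  rw [nnrealLebesgue, Measure.map_apply measurable_real_toNNReal measurableSet_Ioc,
    Measure.restrict_apply (measurable_real_toNNReal measurableSet_Ioc)]
  have : Real.toNNReal ⁻¹' Ioc a b ∩ Ici 0 = Ioc (a : ℝ) b := by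
    ext x
    simp only [mem_inter_iff, mem_preimage, mem_Ioc, mem_Ici, Real.toNNReal_le_iff_le_coe,
      Real.lt_toNNReal_iff_coe_lt]
    exact ⟨fun h => h.1, fun h => ⟨h, a.2.trans h.1.le⟩⟩
  rw [this, Real.volume_Ioc, ENNReal.ofReal_sub _ a.coe_nonneg]
  simp

lemma measurableSet_thinnedSlab {c : ℝ} (hc1 : c ≤ 1) (h : ℝ≥0) (r : ℕ) :
    MeasurableSet (thinnedSlab d c h r) :=
  (measurableSet_thinnedCube hc1).prod measurableSet_Ioc

lemma spaceTimeLebesgue_prod (A : Set (Fin (d + 1) → ℝ)) (a b : ℝ≥0) :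
    spaceTimeLebesgue d (A ×ˢ Ioc a b) = volume A * ((b : ℝ≥0∞) - a) := by
  have : SFinite nnrealLebesgue := by unfold nnrealLebesgue; infer_instance
  rw [spaceTimeLebesgue, Measure.prod_prod, nnrealLebesgue_Ioc]

lemma spaceTimeLebesgue_thinnedSlab {c : ℝ} (hc0 : 0 ≤ c) (hc1 : c ≤ 1) (h : ℝ≥0) (r : ℕ) :
    spaceTimeLebesgue d (thinnedSlab d c h r) = ENNReal.ofReal (c * h) := by
  rw [thinnedSlab, spaceTimeLebesgue_prod, volume_thinnedCube hc1, ENNReal.ofReal_mul hc0]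
  congr 1
  rw [← ENNReal.coe_sub, add_mul, one_mul, add_tsub_cancel_left, ENNReal.ofReal_coe_nnreal]

lemma disjoint_thinnedSlab {c c' : ℝ} {h : ℝ≥0} {r r' : ℕ} (hr : r ≠ r') :
    Disjoint (thinnedSlab d c h r) (thinnedSlab d c' h r') := by
  wlog hlt : r < r' generalizing r r' c c'
  · exact (this hr.symm (by omega)).symm
  rw [Set.disjoint_left]
  rintro z ⟨_, h1⟩ ⟨_, h2⟩
  have h3 : ((r : ℝ≥0) + 1) * h ≤ r' * h := by
    gcongr
    exact_mod_cast hlt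
  exact absurd (h1.2.trans h3) (not_le.2 h2.1)

end Volume

/-! ### Laws of the sampled environment and of the empty slabs -/

section Observation

variable {Ω : Type*} [MeasurableSpace Ω] {P : Measure Ω} {d : ℕ} {Q : ℕ → ℕ → ℝ} {μ : Measure ℕ}
  {Y : ℝ≥0 → Ω → ℕ} {M : Ω → Set ((Fin (d + 1) → ℝ) × ℝ≥0)} {φ : ℕ → ℝ}

lemma IsPoissonPointProcess.measure_encard_eq_zero {E : Type*} [MeasurableSpace E] {Λ : Measure E}
    {M : Ω → Set E} (hM : IsPoissonPointProcess P Λ M) {A : Set E} (hA : MeasurableSet A)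
    {c : ℝ} (hc : 0 ≤ c) (hΛ : Λ A = ENNReal.ofReal c) :
    P {ω | (M ω ∩ A).encard = 0} = ENNReal.ofReal (Real.exp (-c)) := by
  have := hM.poisson_count A hA (by rw [hΛ]; exact ENNReal.ofReal_lt_top) 0
  rw [Nat.cast_zero] at this
  have hc' : ((ENNReal.ofReal c).toNNReal : ℝ) = c := by
    rw [ENNReal.coe_toNNReal_eq_toReal, ENNReal.toReal_ofReal hc]
  rw [this, poissonMeasure_singleton, hΛ, hc']
  simp

/-- Local finiteness is not built into the definition. It holds almost surely because the Poisson
probabilities of the finite counts sum to one. -/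
lemma IsPoissonPointProcess.ae_finite {E : Type*} [MeasurableSpace E] {Λ : Measure E}
    [IsProbabilityMeasure P] {M : Ω → Set E} (hM : IsPoissonPointProcess P Λ M) {A : Set E}
    (hA : MeasurableSet A) (hΛ : Λ A < ∞) : ∀ᵐ ω ∂P, (M ω ∩ A).Finite := by
  have hmeas : ∀ k : ℕ, MeasurableSet {ω | (M ω ∩ A).encard = k} := fun k =>
    hM.measurable_count A hA (measurableSet_singleton _)
  have hU : {ω | (M ω ∩ A).Finite} = ⋃ k : ℕ, {ω | (M ω ∩ A).encard = k} := by
    ext ω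
    simp only [mem_ofPred_eq, mem_iUnion]
    rw [← Set.encard_ne_top_iff, ENat.ne_top_iff_exists]
    simp only [eq_comm]
  have hP : P {ω | (M ω ∩ A).Finite} = 1 := by
    rw [hU, measure_iUnion _ hmeas]
    · simp_rw [hM.poisson_count A hA hΛ]
      have h := measure_eq_tsum_inter_fiber (P := poissonMeasure (Λ A).toNNReal) (f := id)
        (fun a => measurableSet_singleton a) univ
      simpa using h.symm
    · intro i j hij
      rw [Function.onFun, Set.disjoint_left]
      intro ω h1 h2
      exact hij (by exact_mod_cast h1.symm.trans h2)
  have hmS : MeasurableSet {ω | (M ω ∩ A).Finite} := by rw [hU]; exact MeasurableSet.iUnion hmeas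
  exact (prob_compl_eq_zero_iff hmS).2 hP

/-- A Markov jump process observed at the times `k h`, together with the absence of retained Poisson
points in the time slabs, is a thinned chain. -/
theorem isThinnedChain_discretization (hY : IsMarkovJumpProcess P Q μ Y)
    [IsProbabilityMeasure P]
    (hM : IsPoissonPointProcess P (spaceTimeLebesgue d) M)
    (hind : IndepFun (fun ω t => Y t ω)
        (fun ω (A : {A : Set ((Fin (d + 1) → ℝ) × ℝ≥0) // MeasurableSet A}) =>
          (M ω ∩ A.1).encard) P)
    (hφ : ∀ n, φ n ∈ Set.Ioc (0 : ℝ) 1) (h : ℝ≥0) :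
    IsThinnedChain P (fun k => Y (k * h))
      (fun r n => {ω | (M ω ∩ thinnedSlab d (φ n) h r).encard = 0}) (fun n => μ {n})
      (fun n => ENNReal.ofReal (Real.exp (-(φ n * h)))) (fun i j => qSemigroup Q h i j) := by
  intro i m l _
  have hA : ∀ n r, MeasurableSet (thinnedSlab d (φ n) h r) := fun n r =>
    measurableSet_thinnedSlab (hφ n).2 h r
  have hS : MeasurableSet {x : ℝ≥0 → ℕ | ∀ k ≤ m, x ((k : ℝ≥0) * h) = i k} := by
    have : {x : ℝ≥0 → ℕ | ∀ k ≤ m, x ((k : ℝ≥0) * h) = i k} =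
        ⋂ k ∈ Iic m, (fun x : ℝ≥0 → ℕ => x ((k : ℝ≥0) * h)) ⁻¹' {i k} := by ext x; simp
    rw [this]
    exact MeasurableSet.biInter (to_countable _) fun k _ =>
      measurable_pi_apply _ (measurableSet_singleton _)
  have hT : MeasurableSet {x : {A : Set ((Fin (d + 1) → ℝ) × ℝ≥0) // MeasurableSet A} → ℕ∞ |
      ∀ r < l, x ⟨thinnedSlab d (φ (i (r + 1))) h r, hA _ _⟩ = 0} := by
    have : {x : {A : Set ((Fin (d + 1) → ℝ) × ℝ≥0) // MeasurableSet A} → ℕ∞ |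
        ∀ r < l, x ⟨thinnedSlab d (φ (i (r + 1))) h r, hA _ _⟩ = 0} =
        ⋂ r ∈ Iio l, (fun x : {A : Set ((Fin (d + 1) → ℝ) × ℝ≥0) // MeasurableSet A} → ℕ∞ =>
          x ⟨thinnedSlab d (φ (i (r + 1))) h r, hA _ _⟩) ⁻¹' {0} := by ext x; simp
    rw [this]
    exact MeasurableSet.biInter (to_countable _) fun k _ =>
      measurable_pi_apply _ (measurableSet_singleton _)
  have h1 := hind.measure_inter_preimage_eq_mul _ _ hS hT
  simp only [preimage_ofPred_eq] at h1
  have hpath : P {ω | ∀ k ≤ m, Y (k * h) ω = i k} =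
      μ {i 0} * ∏ r ∈ Finset.range m, qSemigroup Q h (i r) (i (r + 1)) := by
    have := hY.finite_dim m (fun k => k * h) i (by simp) fun a b hab => by
      dsimp only
      gcongr
    rw [this]
    congr 1
    refine Finset.prod_congr rfl fun r _ => ?_
    congr 1
    push_cast
    rw [add_mul, one_mul, add_tsub_cancel_left]
  have hcount : P {ω | ∀ r < l, (M ω ∩ thinnedSlab d (φ (i (r + 1))) h r).encard = 0} =
      ∏ r ∈ Finset.range l, ENNReal.ofReal (Real.exp (-(φ (i (r + 1)) * h))) := by
    have hI := hM.independent_counts l (fun r => thinnedSlab d (φ (i (r + 1))) h r)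
      (fun r => hA _ _) fun a b hab => disjoint_thinnedSlab fun heq => hab (Fin.ext heq)
    have h2 := hI.measure_inter_preimage_eq_mul Finset.univ (sets := fun _ => {0})
      fun _ _ => measurableSet_singleton _
    have h3 : {ω | ∀ r < l, (M ω ∩ thinnedSlab d (φ (i (r + 1))) h r).encard = 0} =
        ⋂ r ∈ (Finset.univ : Finset (Fin l)),
          (fun ω => (M ω ∩ thinnedSlab d (φ (i (r + 1))) h r).encard) ⁻¹' {0} := by
      ext ω
      simp only [mem_ofPred_eq, mem_iInter, Finset.mem_univ, mem_preimage, mem_singleton_iff,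
        true_implies]
      exact ⟨fun H r => H r r.2, fun H r hr => H ⟨r, hr⟩⟩
    rw [h3, h2, Finset.prod_range]
    refine Finset.prod_congr rfl fun r _ => ?_
    exact hM.measure_encard_eq_zero (hA _ _) (mul_nonneg (hφ _).1.le h.2)
      (spaceTimeLebesgue_thinnedSlab (hφ _).1.le (hφ _).2 h r)
  rw [← hpath, ← hcount]
  exact h1

lemma IsMarkovJumpProcess.map_eq_evolve (hY : IsMarkovJumpProcess P Q μ Y) (t : ℝ≥0) (A : Set ℕ) :
    P (Y t ⁻¹' A) = evolve μ Q t A := by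
  rw [evolve_apply, measure_eq_tsum_inter_fiber (P := P)
    (fun a => hY.measurable 0 (measurableSet_singleton a))]
  refine tsum_congr fun i => ?_
  rw [measure_eq_tsum_inter_fiber (P := P)
    (fun a => hY.measurable t (measurableSet_singleton a)), ← ENNReal.tsum_mul_left]
  refine tsum_congr fun j => ?_
  by_cases hj : j ∈ A
  · have h := hY.finite_dim 1 (fun k => if k = 0 then 0 else t) (fun k => if k = 0 then i else j)
      (by simp) fun a b hab => by
        dsimp only
        split_ifs with h1 h2
        · exact le_rfl
        · exact zero_le
        · omega
        · exact le_rfl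
    simp only [Finset.range_one, Finset.prod_singleton, if_true, zero_add, one_ne_zero, if_false,
      tsub_zero] at h
    rw [indicator_of_mem hj, Pi.one_apply, mul_one, ← h]
    congr 1
    ext ω
    simp only [mem_inter_iff, mem_preimage, mem_singleton_iff, mem_ofPred_eq]
    constructor
    · rintro ⟨⟨_, h1⟩, h2⟩ k hk
      interval_cases k <;> simpa
    · intro H
      have h0 := H 0 zero_le_one
      have h1 := H 1 le_rfl
      simp only [if_true, one_ne_zero, if_false] at h0 h1
      exact ⟨⟨h1 ▸ hj, h0⟩, h1⟩
  · rw [indicator_of_notMem hj, mul_zero, mul_zero]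
    refine measure_mono_null (t := ∅) ?_ measure_empty
    rintro ω ⟨⟨h1, _⟩, h2⟩
    rw [mem_preimage] at h1 h2
    exact hj (mem_singleton_iff.1 h2 ▸ h1)

end Observation

/-! ### The first jump time as a limit of discretized jump times -/

/-- The time step of the `n`-th discretization. -/
def mesh (n : ℕ) : ℝ≥0 := ((n : ℝ≥0) + 1)⁻¹

lemma mesh_pos (n : ℕ) : 0 < mesh n := by unfold mesh; positivity

lemma mesh_le_one (n : ℕ) : mesh n ≤ 1 := inv_le_one_of_one_le₀ (by simp)

lemma succ_mul_mesh (n : ℕ) : ((n : ℝ≥0) + 1) * mesh n = 1 :=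
  mul_inv_cancel₀ (by positivity)

lemma tendsto_mesh : Tendsto mesh atTop (𝓝 0) := by
  have h : Tendsto (fun n : ℕ => 1 / ((n : ℝ) + 1)) atTop (𝓝 0) :=
    tendsto_one_div_add_atTop_nhds_zero_nat
  rw [← NNReal.tendsto_coe]
  simpa [mesh] using h

lemma exists_mem_Ioc_mul {s h : ℝ≥0} (hs : 0 < s) (hh : 0 < h) :
    ∃ l : ℕ, s ∈ Ioc ((l : ℝ≥0) * h) ((l + 1) * h) := by
  have hpos : 0 < ⌈s / h⌉₊ := Nat.ceil_pos.2 (div_pos hs hh)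
  refine ⟨⌈s / h⌉₊ - 1, ?_, ?_⟩
  · rw [← lt_div_iff₀ hh]
    exact Nat.lt_ceil.1 (by omega)
  · rw [← div_le_iff₀ hh]
    have h1 : ((⌈s / h⌉₊ - 1 : ℕ) : ℝ≥0) + 1 = (⌈s / h⌉₊ : ℝ≥0) := by
      rw [← Nat.cast_succ]
      congr 1
      omega
    rw [h1]
    exact Nat.le_ceil _

/-! ### Pathwise convergence of the discretization -/

section Path

variable {d : ℕ} {φ : ℕ → ℝ} {w : ℝ≥0 → ℕ} {S : Set ((Fin (d + 1) → ℝ) × ℝ≥0)}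

/-- A right-continuous path in a discrete space is constant on some `[s, u)`, and the right end of a
short cell containing `s` lies there. This is why slabs are read at their right end. -/
lemma eventually_right_endpoint_eq {s : ℝ≥0} (hw : ContinuousWithinAt w (Ici s) s) :
    ∀ᶠ n in atTop, ∀ r : ℕ, s ∈ Ioc ((r : ℝ≥0) * mesh n) ((r + 1) * mesh n) →
      w (((r + 1 : ℕ) : ℝ≥0) * mesh n) = w s := by
  have hnhds : w ⁻¹' {w s} ∈ 𝓝[≥] s := hw (by simp)
  obtain ⟨u, hu, hsub⟩ := mem_nhdsGE_iff_exists_Ico_subset.1 hnhds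
  have hu' : 0 < u - s := tsub_pos_of_lt hu
  filter_upwards [tendsto_mesh.eventually (gt_mem_nhds hu')] with n hn r hr
  refine hsub ⟨?_, ?_⟩
  · push_cast; exact hr.2
  · push_cast
    rw [add_mul, one_mul]
    calc (r : ℝ≥0) * mesh n + mesh n < s + (u - s) := add_lt_add hr.1 hn
      _ = u := add_tsub_cancel_of_le hu.le

lemma firstJumpTime_le {z : (Fin (d + 1) → ℝ) × ℝ≥0} (hz : z ∈ retainedPoints φ w S)
    (hz0 : 0 < z.2) : firstJumpTime φ w S ≤ z.2 :=
  sInf_le ⟨z.2, ⟨hz0, z, hz, hz.2.1, hz0, le_rfl⟩, rfl⟩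

/-- Only finitely many points lie in a bounded time window, so the infimum is attained. -/
lemma exists_firstJumpTime_eq
    (hfin : ∀ T : ℕ, (S ∩ originCube d ×ˢ Ioc (0 : ℝ≥0) T).Finite)
    (hτ : firstJumpTime φ w S < ∞) :
    ∃ z ∈ retainedPoints φ w S, 0 < z.2 ∧ firstJumpTime φ w S = z.2 := by
  rw [firstJumpTime, sInf_lt_iff] at hτ
  obtain ⟨_, ⟨r, ⟨_, z, hz, hzc⟩, rfl⟩, _⟩ := hτ
  obtain ⟨T, hT⟩ := exists_nat_ge r
  have hR : (retainedPoints φ w S ∩ originCube d ×ˢ Ioc (0 : ℝ≥0) T).Finite :=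
    (hfin T).subset fun x hx => ⟨hx.1.1, hx.2⟩
  obtain ⟨z₀, hz₀, hmin⟩ := Set.exists_min_image _ (fun x => x.2) hR
    ⟨z, hz, hzc.1, hzc.2.1, hzc.2.2.trans hT⟩
  refine ⟨z₀, hz₀.1, hz₀.2.2.1, le_antisymm (firstJumpTime_le hz₀.1 hz₀.2.2.1) ?_⟩
  refine le_sInf ?_
  rintro _ ⟨r', ⟨_, z', hz', hzc'⟩, rfl⟩
  have hle : z₀.2 ≤ z'.2 := by
    by_cases h : z'.2 ≤ T
    · exact hmin z' ⟨hz', hzc'.1, hzc'.2.1, h⟩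
    · exact hz₀.2.2.2.trans (not_le.1 h).le
  exact ENNReal.coe_le_coe.2 (hle.trans hzc'.2.2)

/-- With finitely many points up to time `T`, one mesh is fine enough for all of them at once. -/
lemma eventually_retained_iff (hw : ∀ s, ContinuousWithinAt w (Ici s) s)
    (hfin : ∀ T : ℕ, (S ∩ originCube d ×ˢ Ioc (0 : ℝ≥0) T).Finite) (T : ℕ) :
    ∀ᶠ n in atTop, ∀ z ∈ S, ∀ r : ℕ, z.2 ≤ T →
      (z ∈ thinnedSlab d (φ (w (((r + 1 : ℕ) : ℝ≥0) * mesh n))) (mesh n) r ↔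
        z ∈ retainedPoints φ w S ∧ z.2 ∈ Ioc ((r : ℝ≥0) * mesh n) ((r + 1) * mesh n)) := by
  have h := (hfin T).eventually_all.2 fun z _ => eventually_right_endpoint_eq (hw z.2)
  filter_upwards [h] with n hn z hzS r hzT
  constructor
  · rintro ⟨hz1, hz2⟩
    have heq := hn z ⟨hzS, hz1.1, lt_of_le_of_lt zero_le hz2.1, hzT⟩ r hz2
    rw [heq] at hz1
    exact ⟨⟨hzS, hz1⟩, hz2⟩
  · rintro ⟨hz1, hz2⟩
    have heq := hn z ⟨hzS, hz1.2.1, lt_of_le_of_lt zero_le hz2.1, hzT⟩ r hz2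
    refine ⟨?_, hz2⟩
    rw [heq]
    exact hz1.2

lemma succ_mul_mesh_le {r n T : ℕ} (hr : r < T * (n + 1)) : ((r : ℝ≥0) + 1) * mesh n ≤ T := by
  have h1 : ((r : ℝ≥0) + 1) ≤ T * ((n : ℝ≥0) + 1) := by exact_mod_cast hr
  calc ((r : ℝ≥0) + 1) * mesh n ≤ T * ((n : ℝ≥0) + 1) * mesh n := by gcongr
    _ = T := by rw [mul_assoc, succ_mul_mesh, mul_one]

lemma lt_of_mul_mesh_lt {l n T : ℕ} (hl : (l : ℝ≥0) * mesh n < T) : l < T * (n + 1) := by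
  have h1 : (l : ℝ≥0) * mesh n * ((n : ℝ≥0) + 1) < T * ((n : ℝ≥0) + 1) := by
    gcongr
  rw [mul_assoc, mul_comm (mesh n), succ_mul_mesh, mul_one] at h1
  exact_mod_cast h1

end Path

section Discretization

variable {Ω : Type*} {d : ℕ} {φ : ℕ → ℝ} {Y : ℝ≥0 → Ω → ℕ}
  {M : Ω → Set ((Fin (d + 1) → ℝ) × ℝ≥0)} {ω : Ω}

/-- The environment observed at multiples of the `n`-th time step. -/
def meshChain (Y : ℝ≥0 → Ω → ℕ) (n k : ℕ) : Ω → ℕ := Y (k * mesh n)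

/-- The event that no Poisson point is retained in the `r`-th slab in environment state `m`. -/
def meshEmpty (φ : ℕ → ℝ) (M : Ω → Set ((Fin (d + 1) → ℝ) × ℝ≥0)) (n r m : ℕ) : Set Ω :=
  {ω | (M ω ∩ thinnedSlab d (φ m) (mesh n) r).encard = 0}

lemma eventually_mem_survival (hw : ∀ s, ContinuousWithinAt (fun t => Y t ω) (Ici s) s)
    (hfin : ∀ T : ℕ, (M ω ∩ originCube d ×ˢ Ioc (0 : ℝ≥0) T).Finite) {T : ℕ}
    (hτ : (T : ℝ≥0∞) < firstJumpTime φ (fun t => Y t ω) (M ω)) :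
    ∀ᶠ n in atTop, ω ∈ survival (meshChain Y n) (meshEmpty φ M n) (T * (n + 1)) := by
  filter_upwards [eventually_retained_iff (φ := φ) hw hfin T] with n hn r hr
  simp only [meshEmpty, meshChain, mem_ofPred_eq, Set.encard_eq_zero]
  rw [← Set.not_nonempty_iff_eq_empty]
  rintro ⟨z, hzM, hz⟩
  have hzT : z.2 ≤ T := hz.2.2.trans (succ_mul_mesh_le hr)
  obtain ⟨h1, h2⟩ := (hn z hzM r hzT).1 hz
  have h3 := firstJumpTime_le h1 (lt_of_le_of_lt zero_le h2.1)
  have h4 : (z.2 : ℝ≥0∞) ≤ T := by exact_mod_cast hzT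
  exact absurd (h3.trans h4) (not_le.2 hτ)

lemma eventually_exists_killed (hw : ∀ s, ContinuousWithinAt (fun t => Y t ω) (Ici s) s)
    (hfin : ∀ T : ℕ, (M ω ∩ originCube d ×ˢ Ioc (0 : ℝ≥0) T).Finite) {T : ℕ}
    (hτ : firstJumpTime φ (fun t => Y t ω) (M ω) < T) :
    ∀ᶠ n in atTop, ∃ l < T * (n + 1), ω ∈ survival (meshChain Y n) (meshEmpty φ M n) l ∧
      ω ∉ meshEmpty φ M n l (meshChain Y n (l + 1) ω) ∧
      meshChain Y n (l + 1) ω = Y (firstJumpTime φ (fun t => Y t ω) (M ω)).toNNReal ω := by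
  obtain ⟨z₀, hz₀, hpos, heq⟩ :=
    exists_firstJumpTime_eq hfin (hτ.trans (ENNReal.natCast_lt_top T))
  have hz₀T : z₀.2 < T := by
    rw [heq] at hτ
    exact_mod_cast hτ
  rw [heq, ENNReal.toNNReal_coe]
  filter_upwards [eventually_retained_iff (φ := φ) hw hfin T,
    eventually_right_endpoint_eq (hw z₀.2)] with n hn hn₀
  obtain ⟨l, hl⟩ := exists_mem_Ioc_mul hpos (mesh_pos n)
  refine ⟨l, lt_of_mul_mesh_lt (hl.1.trans hz₀T), fun r hr => ?_, ?_, hn₀ l hl⟩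
  · simp only [meshEmpty, meshChain, mem_ofPred_eq, Set.encard_eq_zero]
    rw [← Set.not_nonempty_iff_eq_empty]
    rintro ⟨z, hzM, hz⟩
    have hrl : ((r : ℝ≥0) + 1) * mesh n ≤ l * mesh n := by
      gcongr
      exact_mod_cast hr
    have hlt : z.2 < z₀.2 := (hz.2.2.trans hrl).trans_lt hl.1
    obtain ⟨h1, h2⟩ := (hn z hzM r (hlt.trans hz₀T).le).1 hz
    have h3 := firstJumpTime_le h1 (lt_of_le_of_lt zero_le h2.1)
    rw [heq, ENNReal.coe_le_coe] at h3
    exact absurd h3 (not_le.2 hlt)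
  · simp only [meshEmpty, meshChain, mem_ofPred_eq, Set.encard_eq_zero]
    rw [← Ne, ← Set.nonempty_iff_ne_empty]
    exact ⟨z₀, hz₀.1, (hn z₀ hz₀.1 l hz₀T.le).2 ⟨hz₀, hl⟩⟩

/-- The environment at the discretized first jump time (`0` if there is no early jump). -/
def meshStateAtJump (φ : ℕ → ℝ) (Y : ℝ≥0 → Ω → ℕ) (M : Ω → Set ((Fin (d + 1) → ℝ) × ℝ≥0))
    (n : ℕ) (ω : Ω) : ℕ :=
  -- These slabs cover `(0, n + 1]`, a horizon that eventually passes any finite jump time. At most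
  -- one summand is active.
  ∑ l ∈ Finset.range ((n + 1) * (n + 1)),
    (survival (meshChain Y n) (meshEmpty φ M n) l \
      {ω | ω ∈ meshEmpty φ M n l (meshChain Y n (l + 1) ω)}).indicator (meshChain Y n (l + 1)) ω

lemma eventually_meshStateAtJump_eq (hw : ∀ s, ContinuousWithinAt (fun t => Y t ω) (Ici s) s)
    (hfin : ∀ T : ℕ, (M ω ∩ originCube d ×ˢ Ioc (0 : ℝ≥0) T).Finite)
    (hτ : firstJumpTime φ (fun t => Y t ω) (M ω) < ∞) :
    ∀ᶠ n in atTop, meshStateAtJump φ Y M n ω =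
      Y (firstJumpTime φ (fun t => Y t ω) (M ω)).toNNReal ω := by
  obtain ⟨T, hT⟩ := ENNReal.exists_nat_gt hτ.ne
  filter_upwards [eventually_exists_killed hw hfin hT, eventually_ge_atTop T] with n hn hnT
  obtain ⟨l, hl, hs, he, hY⟩ := hn
  rw [meshStateAtJump, Finset.sum_eq_single l]
  · have hmem : ω ∈ survival (meshChain Y n) (meshEmpty φ M n) l \
        {ω | ω ∈ meshEmpty φ M n l (meshChain Y n (l + 1) ω)} := ⟨hs, he⟩
    rw [indicator_of_mem hmem, hY]
  · intro l' _ hne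
    refine indicator_of_notMem (fun h => ?_) _
    rcases lt_or_gt_of_ne hne with h' | h'
    · exact h.2 (hs l' h')
    · exact he (h.1 l h')
  · intro hl'
    refine absurd (Finset.mem_range.2 (hl.trans_le ?_)) hl'
    exact Nat.mul_le_mul_right _ (by omega)

end Discretization

/-- A limit inferior of events is no likelier than the limit of bounds on their probabilities. -/
lemma measure_le_of_ae_eventually_mem {Ω : Type*} [MeasurableSpace Ω] {P : Measure Ω} {S : Set Ω}
    {E : ℕ → Set Ω} {c : ℕ → ℝ≥0∞} {c₀ : ℝ≥0∞} (hS : ∀ᵐ ω ∂P, ω ∈ S → ∀ᶠ n in atTop, ω ∈ E n)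
    (hE : ∀ n, P (E n) ≤ c n) (hc : Tendsto c atTop (𝓝 c₀)) : P S ≤ c₀ := by
  have h1 : P S ≤ P (⋃ n, ⋂ m ≥ n, E m) := by
    refine measure_mono_ae ?_
    filter_upwards [hS] with ω hω hωS
    obtain ⟨n, hn⟩ := eventually_atTop.1 (hω hωS)
    exact mem_iUnion.2 ⟨n, mem_iInter₂.2 hn⟩
  have hmono : Monotone fun n => ⋂ m ≥ n, E m := fun a b hab =>
    biInter_subset_biInter_left fun m hm => le_trans hab hm
  rw [hmono.measure_iUnion] at h1
  refine h1.trans (iSup_le fun n => ge_of_tendsto hc ?_)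
  filter_upwards [eventually_ge_atTop n] with m hm
  exact (measure_mono (biInter_subset_of_mem hm)).trans (hE m)

/-! ### The environment at the first jump time -/

section FirstJump

variable {Ω : Type*} [MeasurableSpace Ω] {P : Measure Ω} {d : ℕ}
  {p q φ : ℕ → ℝ} {Y : ℝ≥0 → Ω → ℕ} {M : Ω → Set ((Fin (d + 1) → ℝ) × ℝ≥0)}

lemma measurableSet_meshEmpty (hM : IsPoissonPointProcess P (spaceTimeLebesgue d) M)
    (hφ : ∀ n, φ n ∈ Set.Ioc (0 : ℝ) 1) (n r m : ℕ) : MeasurableSet (meshEmpty φ M n r m) :=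
  hM.measurable_count _ (measurableSet_thinnedSlab (hφ m).2 _ _) (measurableSet_singleton 0)

lemma ae_finite_cube [IsProbabilityMeasure P]
    (hM : IsPoissonPointProcess P (spaceTimeLebesgue d) M) :
    ∀ᵐ ω ∂P, ∀ T : ℕ, (M ω ∩ originCube d ×ˢ Ioc (0 : ℝ≥0) T).Finite := by
  refine ae_all_iff.2 fun T => hM.ae_finite ?_ ?_
  · rw [← thinnedCube_one]
    exact (measurableSet_thinnedCube le_rfl).prod measurableSet_Ioc
  · rw [spaceTimeLebesgue_prod, ← thinnedCube_one, volume_thinnedCube le_rfl]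
    simp

lemma tendsto_bdEquilibrium_compl_Iic (μ : Measure ℕ) [IsFiniteMeasure μ] :
    Tendsto (fun N => μ (Iic N)ᶜ) atTop (𝓝 0) := by
  have h := tendsto_measure_iInter_atTop (μ := μ) (s := fun N : ℕ => (Iic N)ᶜ)
    (fun N => MeasurableSet.of_discrete.nullMeasurableSet)
    (fun a b hab => compl_subset_compl.2 (Iic_subset_Iic.2 hab)) ⟨0, measure_ne_top _ _⟩
  have hempty : ⋂ N : ℕ, (Iic N)ᶜ = ∅ := by
    ext x
    simp only [mem_iInter, mem_compl_iff, mem_Iic, mem_empty_iff_false, iff_false, not_forall,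
      not_not]
    exact ⟨x, le_rfl⟩
  rwa [hempty, measure_empty] at h

theorem ae_firstJumpTime_lt_top [IsProbabilityMeasure P] (hp : ∀ n, 0 < p n)
    (hp1 : ∀ n, p n ≤ 1)
    (hq : ∀ n, 1 ≤ n → 0 < q n) (herg : Summable fun n => bdWeight p q n)
    (hφ : ∀ n, φ n ∈ Set.Ioc (0 : ℝ) 1) (hφ_anti : Antitone φ)
    (hY : IsMarkovJumpProcess P (bdGenerator p q) (bdEquilibrium p q) Y)
    (hM : IsPoissonPointProcess P (spaceTimeLebesgue d) M)
    (hind : IndepFun (fun ω t => Y t ω)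
        (fun ω (A : {A : Set ((Fin (d + 1) → ℝ) × ℝ≥0) // MeasurableSet A}) =>
          (M ω ∩ A.1).encard) P) :
    ∀ᵐ ω ∂P, firstJumpTime φ (fun t => Y t ω) (M ω) < ∞ := by
  have := isProbabilityMeasure_bdEquilibrium hp hq herg
  set S := {ω | ¬ firstJumpTime φ (fun t => Y t ω) (M ω) < ∞} with hS
  have hdom : ∀ (t : ℝ≥0) (N : ℕ), P (Y t ⁻¹' (Iic N)ᶜ) ≤ bdEquilibrium p q (Iic N)ᶜ :=
    fun t N => by
      -- Taking `φ = 1` gives a tail bound uniform in time, which replaces stationarity of `ν`.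
      have h := stochDominated_evolve_timeChanged hp hp1 hq herg (φ := fun _ => 1)
        (fun _ => ⟨zero_lt_one, le_rfl⟩) antitone_const t N
      rwa [timeChanged_one, ← hY.map_eq_evolve] at h
  have hbound : ∀ N T : ℕ, P S ≤ bdEquilibrium p q (Iic N)ᶜ +
      ENNReal.ofReal (Real.exp (-(φ N))) ^ T := fun N T => by
    refine measure_le_of_ae_eventually_mem
      (E := fun n => survival (meshChain Y n) (meshEmpty φ M n) (T * (n + 1))) ?_ (fun n => ?_)
      tendsto_const_nhds
    · filter_upwards [ae_finite_cube hM] with ω hfin hω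
      refine eventually_mem_survival (hY.right_continuous ω) hfin ?_
      exact lt_of_lt_of_le (ENNReal.natCast_lt_top T) (not_lt.1 hω)
    · have h := measure_survival_le (N := N) (δ := bdEquilibrium p q (Iic N)ᶜ)
        (D' := ENNReal.ofReal (Real.exp (-(φ N * mesh n)))) (fun k => hY.measurable _)
        (isThinnedChain_discretization hY hM hind hφ (mesh n)) (fun k => hdom _ N)
        (fun m hm => ENNReal.ofReal_le_ofReal (Real.exp_le_exp.2 (neg_le_neg
          (mul_le_mul_of_nonneg_right (hφ_anti hm) (mesh n).coe_nonneg))))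
        (ENNReal.ofReal_le_one.2 (Real.exp_le_one_iff.2 (neg_nonpos.2
          (mul_nonneg (hφ N).1.le (mesh n).coe_nonneg)))) (T * (n + 1))
      refine h.trans_eq ?_
      congr 1
      -- The `n + 1` steps in a unit of time multiply to `e^{-φ(N)}`, whatever the mesh.
      rw [mul_comm T, pow_mul, ← ENNReal.ofReal_pow (Real.exp_pos _).le, ← Real.exp_nat_mul]
      have h1 : ((n : ℝ) + 1) * mesh n = 1 := by exact_mod_cast succ_mul_mesh n
      congr 4
      push_cast
      linear_combination -φ N * h1
  have hbound' : ∀ N : ℕ, P S ≤ bdEquilibrium p q (Iic N)ᶜ := fun N => by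
    have hlt : ENNReal.ofReal (Real.exp (-(φ N))) < 1 := by
      rw [ENNReal.ofReal_lt_one]
      exact Real.exp_lt_one_iff.2 (neg_lt_zero.2 (hφ N).1)
    have h := (ENNReal.tendsto_pow_atTop_nhds_zero_of_lt_one hlt).const_add
      (bdEquilibrium p q (Iic N)ᶜ)
    rw [add_zero] at h
    exact ge_of_tendsto' h (hbound N)
  exact le_antisymm (ge_of_tendsto' (tendsto_bdEquilibrium_compl_Iic _) hbound') zero_le

/-- The state at the jump is an almost sure limit of the discretized states, which are measurable by
construction. -/
theorem aemeasurable_state_firstJumpTime [IsProbabilityMeasure P]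
    (hφ : ∀ n, φ n ∈ Set.Ioc (0 : ℝ) 1)
    {Q : ℕ → ℕ → ℝ} {μ : Measure ℕ} (hY : IsMarkovJumpProcess P Q μ Y)
    (hM : IsPoissonPointProcess P (spaceTimeLebesgue d) M)
    (hτ : ∀ᵐ ω ∂P, firstJumpTime φ (fun t => Y t ω) (M ω) < ∞) :
    AEMeasurable (fun ω => Y (firstJumpTime φ (fun t => Y t ω) (M ω)).toNNReal ω) P := by
  refine aemeasurable_of_tendsto_metrizable_ae atTop (f := meshStateAtJump φ Y M)
    (fun n => Measurable.aemeasurable ?_) ?_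
  · have hy : ∀ k, Measurable (meshChain Y n k) := fun k => hY.measurable _
    have he := measurableSet_meshEmpty hM hφ n
    unfold meshStateAtJump
    exact Finset.measurable_fun_sum _ fun l _ => (hy (l + 1)).indicator
      ((measurableSet_survival hy he l).diff (measurableSet_step hy he l))
  · filter_upwards [hτ, ae_finite_cube hM] with ω hω hfin
    exact tendsto_nhds_of_eventually_eq
      (eventually_meshStateAtJump_eq (hY.right_continuous ω) hfin hω)

/-- The probability that the discretized environment is above `k` at the first jump. -/
lemma measure_killedIn_mesh_le [IsProbabilityMeasure P] (hp : ∀ n, 0 ≤ p n) (hq : ∀ n, 1 ≤ n → 0 ≤ q n)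
    (hrate : ∀ i, p i + deathRate q i ≤ 1) (hφ : ∀ n, φ n ∈ Set.Ioc (0 : ℝ) 1)
    (hY : IsMarkovJumpProcess P (bdGenerator p q) (bdEquilibrium p q) Y)
    (hM : IsPoissonPointProcess P (spaceTimeLebesgue d) M)
    (hind : IndepFun (fun ω t => Y t ω)
        (fun ω (A : {A : Set ((Fin (d + 1) → ℝ) × ℝ≥0) // MeasurableSet A}) =>
          (M ω ∩ A.1).encard) P) {v : ℕ → ℝ} {B : Set ℕ} (hv0 : ∀ i, 0 ≤ v i)
    (hv1 : ∀ i, v i ≤ 1) (hsuper : ∀ i, bdDrift p q v i ≤ φ i * (v i - B.indicator 1 i))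
    (n T : ℕ) :
    P (killedIn (meshChain Y n) (meshEmpty φ M n) B (T * (n + 1))) ≤
      ∑' i, ENNReal.ofReal (bdProb p q i) * ENNReal.ofReal (v i) +
        ENNReal.ofReal (5 * T * mesh n) := by
  have hB : ∀ b, (B.indicator 1 b : ℝ≥0∞) = ENNReal.ofReal (B.indicator 1 b) := fun b => by
    by_cases hb : b ∈ B <;> simp [hb]
  have h := measure_killedIn_le (v := fun i => ENNReal.ofReal (v i)) (B := B)
    (ε := ENNReal.ofReal (5 * (mesh n : ℝ) ^ 2)) (fun k => hY.measurable _)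
    (isThinnedChain_discretization hY hM hind hφ (mesh n)) (measurableSet_meshEmpty hM hφ n)
    (fun a => by
      simp only [hB]
      exact tsum_qSemigroup_thinned_le hp hq hrate hφ hv0 hv1
        (fun i => indicator_nonneg (fun _ _ => zero_le_one) i)
        (fun i => indicator_le_self' (fun _ _ => zero_le_one) i) hsuper (mesh_le_one n) a)
    (T * (n + 1))
  simp only [bdEquilibrium_singleton] at h
  refine h.trans_eq ?_
  congr 1
  rw [← ENNReal.ofReal_natCast, ← ENNReal.ofReal_mul (Nat.cast_nonneg _)]
  have h1 : ((n : ℝ) + 1) * mesh n = 1 := by exact_mod_cast succ_mul_mesh n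
  congr 1
  push_cast
  linear_combination 5 * (T : ℝ) * mesh n * h1

theorem stochDominated_state_firstJumpTime [IsProbabilityMeasure P] (hp : ∀ n, 0 < p n)
    (hp1 : ∀ n, p n ≤ 1)
    (hq : ∀ n, 1 ≤ n → 0 < q n) (hrate : ∀ i, p i + deathRate q i ≤ 1)
    (herg : Summable fun n => bdWeight p q n)
    (hφ : ∀ n, φ n ∈ Set.Ioc (0 : ℝ) 1) (hφ_anti : Antitone φ)
    (hY : IsMarkovJumpProcess P (bdGenerator p q) (bdEquilibrium p q) Y)
    (hM : IsPoissonPointProcess P (spaceTimeLebesgue d) M)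
    (hind : IndepFun (fun ω t => Y t ω)
        (fun ω (A : {A : Set ((Fin (d + 1) → ℝ) × ℝ≥0) // MeasurableSet A}) =>
          (M ω ∩ A.1).encard) P) :
    StochDominated (P.map fun ω => Y (firstJumpTime φ (fun t => Y t ω) (M ω)).toNNReal ω)
      (bdEquilibrium p q) := by
  intro k
  have hτ := ae_firstJumpTime_lt_top hp hp1 hq herg hφ hφ_anti hY hM hind
  rw [Measure.map_apply_of_aemeasurable (aemeasurable_state_firstJumpTime hφ hY hM hτ)
    MeasurableSet.of_discrete]
  set S := (fun ω => Y (firstJumpTime φ (fun t => Y t ω) (M ω)).toNNReal ω) ⁻¹' (Iic k)ᶜ with hS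
  -- The discretization error `5 T * mesh n` vanishes only for fixed `T`; the horizon is removed
  -- last, by monotone continuity of `P`.
  set F : ℕ → Set Ω := fun T => S ∩ {ω | firstJumpTime φ (fun t => Y t ω) (M ω) < T} with hF
  have hFle : ∀ T, P (F T) ≤ bdEquilibrium p q (Iic k)ᶜ := fun T => by
    refine ENNReal.le_of_forall_pos_le_add fun ε hε _ => ?_
    obtain ⟨v, hv0, hv1, hsuper, hv⟩ := exists_superharmonic hp hp1 hq herg hφ hφ_anti k
      (show (0 : ℝ) < ε from hε)
    rw [ENNReal.ofReal_coe_nnreal] at hv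
    refine le_trans ?_ hv
    have hlim : Tendsto (fun n => ∑' i, ENNReal.ofReal (bdProb p q i) * ENNReal.ofReal (v i) +
        ENNReal.ofReal (5 * T * mesh n)) atTop
        (𝓝 (∑' i, ENNReal.ofReal (bdProb p q i) * ENNReal.ofReal (v i))) := by
      have h1 := ENNReal.tendsto_ofReal
        ((NNReal.tendsto_coe.2 tendsto_mesh).const_mul (5 * (T : ℝ)))
      have h2 := h1.const_add (∑' i, ENNReal.ofReal (bdProb p q i) * ENNReal.ofReal (v i))
      simpa using h2
    refine measure_le_of_ae_eventually_mem ?_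
      (fun n => measure_killedIn_mesh_le (fun n => (hp n).le) (fun n hn => (hq n hn).le) hrate hφ
        hY hM hind hv0 hv1 hsuper n T) hlim
    filter_upwards [ae_finite_cube hM] with ω hfin hω
    filter_upwards [eventually_exists_killed (hY.right_continuous ω) hfin hω.2] with n hn
    obtain ⟨l, hl, hs, he, hl2⟩ := hn
    exact ⟨l, hl, hs, he, by rw [hl2]; exact hω.1⟩
  have hmono : Monotone F := fun a b hab ω hω => by
    have h : firstJumpTime φ (fun t => Y t ω) (M ω) < a := hω.2
    refine ⟨hω.1, ?_⟩
    rw [mem_ofPred_eq]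
    exact h.trans_le (by exact_mod_cast hab)
  have hSF : P S ≤ P (⋃ T, F T) := by
    refine measure_mono_ae ?_
    filter_upwards [hτ] with ω hω hωS
    obtain ⟨T, hT⟩ := ENNReal.exists_nat_gt hω.ne
    exact mem_iUnion.2 ⟨T, hωS, hT⟩
  rw [hmono.measure_iUnion] at hSF
  exact hSF.trans (iSup_le hFle)

end FirstJump

end

theorem lemma3p2 (p q φ : ℕ → ℝ)
    (hp : ∀ n, p n ∈ Set.Ioo (0 : ℝ) 1)
    (hq : ∀ n, 1 ≤ n → q n ∈ Set.Ioo (0 : ℝ) 1)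
    (hpq : ∀ n, 1 ≤ n → p n + q n = 1)
    (herg : Summable fun n => bdWeight p q n)
    (hle : ∀ n, 1 ≤ n → p n ≤ q n)
    (hinf : ∃ c : ℝ, 0 < c ∧ ∀ n, c ≤ p n)
    (hstrong : Summable fun n => bdS p q (n + 1) ^ 2 / bdR p q (n + 1))
    (hφ : ∀ n, φ n ∈ Set.Ioc (0 : ℝ) 1)
    (hφ_anti : Antitone φ) (hφ_zero : φ 0 = 1) (hφ_lim : Tendsto φ atTop (𝓝 0)) :
    (∀ t : ℝ≥0,
      IsProbabilityMeasure
        (evolve (bdEquilibrium p q) (timeChanged φ (bdGenerator p q)) t) ∧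
      StochDominated (evolve (bdEquilibrium p q) (timeChanged φ (bdGenerator p q)) t)
        (bdEquilibrium p q)) ∧
    (∀ (d : ℕ) (Ω : Type*) [MeasurableSpace Ω] (P : Measure Ω) [IsProbabilityMeasure P]
      (Y : ℝ≥0 → Ω → ℕ) (M : Ω → Set ((Fin (d + 1) → ℝ) × ℝ≥0)),
      IsMarkovJumpProcess P (bdGenerator p q) (bdEquilibrium p q) Y →
      IsPoissonPointProcess P (spaceTimeLebesgue d) M →
      IndepFun (fun ω t => Y t ω)
        (fun ω (A : {A : Set ((Fin (d + 1) → ℝ) × ℝ≥0) // MeasurableSet A}) =>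
          (M ω ∩ A.1).encard) P →
      (∀ᵐ ω ∂P, firstJumpTime φ (fun t => Y t ω) (M ω) < ∞) ∧
      AEMeasurable (fun ω => Y (firstJumpTime φ (fun t => Y t ω) (M ω)).toNNReal ω) P ∧
      StochDominated
        (P.map fun ω => Y (firstJumpTime φ (fun t => Y t ω) (M ω)).toNNReal ω)
        (bdEquilibrium p q)) := by
  have hp0 : ∀ n, 0 < p n := fun n => (hp n).1
  have hp1 : ∀ n, p n ≤ 1 := fun n => (hp n).2.le
  have hq0 : ∀ n, 1 ≤ n → 0 < q n := fun n hn => (hq n hn).1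
  have hrate : ∀ i, p i + deathRate q i ≤ 1 := fun i => by
    rcases i with _ | i
    · simpa using hp1 0
    · simpa using (hpq (i + 1) (by omega)).le
  refine ⟨fun t => ⟨isProbabilityMeasure_evolve_timeChanged hp0 hp1 hq0 herg hφ t,
    stochDominated_evolve_timeChanged hp0 hp1 hq0 herg hφ hφ_anti t⟩, ?_⟩
  intro d Ω _ P _ Y M hY hM hind
  have hτ := ae_firstJumpTime_lt_top hp0 hp1 hq0 herg hφ hφ_anti hY hM hind
  exact ⟨hτ, aemeasurable_state_firstJumpTime hφ hY hM hτ,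
    stochDominated_state_firstJumpTime hp0 hp1 hq0 hrate herg hφ hφ_anti hY hM hind⟩
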